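/- **Conventions.** Categories are locally small; $\mathbf{Set}$ denotes small sets. An *ultrafamily* in a category $C$ is a triple $(X,b,\nu)$ of a set $X$, a family $(b_x)_{x\in X}$ of objects of $C$ and an ultrafilter $\nu$ on $X$. The category $\beta C$ has ultrafamilies as objects; an arrow $(X,b,\nu)\to(Y,c,\xi)$ is represented by a function $g\colon Y\to X$ with $g_*\xi=\nu$ together with arrows $b_{g(y)}\to c_y$ $(y\in Y)$, two representatives being identified when they agree for $\xi$-almost all $y$. Let $\eta_C\colon C\to\beta C$, $c\mapsto(c)_{*:1}$, be the one-element ultrafamilies, and let $\mu_C\colon\beta\beta C\to\beta C$, $(X,(Y_x,c_x,\xi_x)_x,\nu)\mapsto(\sum_xY_x,(c_{x,y})_{(x,y)},\sum_{x:\nu}\xi_x)$, be the sum of ultrafamilies. A profunctor $P\colon C⇸D$ is a functor $D^{\mathrm{op}}\times C\to\mathbf{Set}$; profunctors are composed by coends, 2-cells are natural transformations, and $P$ is small if every presheaf $P(-,c)$ is a small colimit of representables. For a functor $f\colon C\to D$ let $f_\diamond(d,c)=D(d,f(c))$ and $f^\diamond(c,d)=D(f(c),d)$. The action of $\beta$ on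 functors extends to profunctors by $\underline\beta P=(\beta\pi_1)_\diamond\circ(\beta\pi_2)^\diamond$, where $D\xleftarrow{\pi_1}R\xrightarrow{\pi_2}C$ is the category of elements of $P$. Equivalently, an element of $\underline\beta P((X,b,\nu),(Y,c,\xi))$ is represented by a function $g\colon Y\to X$ with $g_*\xi=\nu$ and a family of elements of $P(b_{g(y)},c_y)$, modulo agreement for $\xi$-almost all $y$. In particular $\underline\beta(f_\diamond)\cong(\beta f)_\diamond$. **Ultraconvergence spaces.** An ultraconvergence space $A$ on a discrete category $A_0$ consists of a small profunctor $A\colon\beta A_0⇸A_0$, elements $\mathrm{id}_a\in A(a,\eta(a))$, and, for every $r\in A(a,(X,b,\nu))$ and every family $s_x\in A(b_x,(Y_x,c_x,\xi_x))$ $(x\in X)$, a composite $(s_x)_{x:\nu}\cdot r\in A(a,(c_{x,y})_{(x,y):\sum_{x:\nu}\xi_x})$, such that, writing $r[g]=A(\mathrm{id},g)(r)$, 1. $(s_{g(y)})_{y:\xi}\cdot r[g]=((s_x)_{x:\nu}\cdot r)[g\otimes\mathrm{id}]$; 2. $(s_x[g_x])_{x:\nu}\cdot r=((s_x)_{x:\nu}\cdot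 r)[\mathrm{id}\otimes(g_x)_{x:\nu}]$; 3. $(r)_{*:1}\cdot\mathrm{id}_a=r$; 4. $(\mathrm{id}_{b_x})_{x:\nu}\cdot r=r$; 5. $(t_{x,y})_{(x,y)}\cdot((s_x)_{x:\nu}\cdot r)=((t_{x,y})_{y:\xi_x}\cdot s_x)_{x:\nu}\cdot r$, where $g\otimes\mathrm{id}$ is given by $(y,z)\mapsto(g(y),z)$ and $\mathrm{id}\otimes(g_x)_{x:\nu}$ by $(x,z)\mapsto(x,g_x(z))$, and where 3–5 are read along the canonical isomorphisms between the targets. For ultraconvergence spaces $A,A'$ and a functor $f\colon A_0\to A_0'$, a *continuity structure* on $f$ is a family of functions $A(a,(X,b,\nu))\to A'(f(a),(X,fb,\nu))$, $r\mapsto f(r)$, with $f(r[g])=f(r)[g]$, $f(\mathrm{id}_a)=\mathrm{id}_{f(a)}$ and $f((s_x)_{x:\nu}\cdot r)=(f(s_x))_{x:\nu}\cdot f(r)$. **Lax algebras.** A lax $\underline\beta$-algebra on a category $A_0$ is a small profunctor $a\colon\beta A_0⇸A_0$ with 2-cells $\Gamma\colon1\Rightarrow a\circ\eta_\diamond$ and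 $\Delta\colon a\circ\underline\beta a\Rightarrow a\circ\mu_\diamond$ satisfying the two unit laws and the associativity law of a lax algebra. An ultraconvergence space $A$ determines the lax algebra with $a=A$, with $\Gamma$ given by the identities $\mathrm{id}_a$, and with $\Delta$ sending the class of $r\in A(a,(X,b,\nu))$ and of $(g,(s_y)_y)\in\underline\beta A((X,b,\nu),(Y,C,\xi))$ to $(s_y)_{y:\xi}\cdot r[g]$. The structure of a *colax morphism* $(a,\Gamma,\Delta)\to(a',\Gamma',\Delta')$ on $f_\diamond$ is a 2-cell $\Theta\colon f_\diamond\circ a\Rightarrow a'\circ\underline\beta(f_\diamond)$ such that * (a) the composite $f_\diamond\xRightarrow{\Gamma}f_\diamond\circ a\circ\eta_\diamond\xRightarrow{\Theta}a'\circ\underline\beta f_\diamond\circ\eta_\diamond\cong a'\circ\eta_\diamond\circ f_\diamond$ equals $f_\diamond\xRightarrow{\Gamma'}a'\circ\eta_\diamond\circ f_\diamond$; * (b) the composite $f_\diamond\circ a\circ\underline\beta a\xRightarrow{\Theta}a'\circ\underline\beta f_\diamond\circ\underline\beta a\xRightarrow{\underline\beta\Theta}a'\circ\underline\beta a'\circ\underline\beta\,\underline\beta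 f_\diamond\xRightarrow{\Delta'}a'\circ\mu_\diamond\circ\underline\beta\,\underline\beta f_\diamond$ equals $f_\diamond\circ a\circ\underline\beta a\xRightarrow{\Delta}f_\diamond\circ a\circ\mu_\diamond\xRightarrow{\Theta}a'\circ\underline\beta f_\diamond\circ\mu_\diamond\cong a'\circ\mu_\diamond\circ\underline\beta\,\underline\beta f_\diamond$. **Proposition.** Let $A$ and $A'$ be ultraconvergence spaces on discrete categories $A_0$ and $A_0'$, and let $f\colon A_0\to A_0'$ be a functor. There is a bijection between 1. continuity structures $A\to A'$ on $f$, and 2. structures of a colax morphism of lax $\underline\beta$-algebras $A\to A'$ on $f_\diamond$. Under it, a continuity structure $r\mapsto f(r)$ corresponds to the 2-cell $\Theta$ whose value at the class of $(\mathrm{id}_{f(a)},r)$, for $r\in A(a,(X,b,\nu))$, is the class of $f(r)\in A'(f(a),(X,fb,\nu))$ and the identity of $(X,fb,\nu)$, under $(A'\circ\underline\beta f_\diamond)(f(a),(X,b,\nu))\cong A'(f(a),(X,fb,\nu))$. -/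

import Mathlib

open CategoryTheory Opposite

universe u v v' v'' w

namespace Ultraconvergence

/-! ### Ultrafamilies and germs -/

/-- An ultrafamily in `C`: a set, a family of objects of `C` indexed by it, and an ultrafilter
on it.  These are the objects of the category `β C`. -/
structure Ultrafamily (C : Type (u + 1)) : Type (u + 1) where
  idx : Type u
  fam : idx → C
  ult : Ultrafilter idx

variable {B C D E : Type (u + 1)}

/-- Representatives of germs between ultrafamilies `S = (X, h, ν)` and `T = (Y, k, ξ)`:
a function `g : Y → X` pushing `ξ` forward to `ν`, and a family of elements
`el y ∈ H (h (g y)) (k y)`. -/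
structure PreGerm (H : D → C → Type v) (S : Ultrafamily.{u} D) (T : Ultrafamily.{u} C) :
    Type (max u v) where
  fn : T.idx → S.idx
  map_fn : T.ult.map fn = S.ult
  el : ∀ y, H (S.fam (fn y)) (T.fam y)

namespace PreGerm

variable {H : D → C → Type v} {S : Ultrafamily.{u} D} {T : Ultrafamily.{u} C}

/-- The value `(g y, el y)` of a representative at a point. -/
def val (p : PreGerm H S T) (y : T.idx) : Σ x, H (S.fam x) (T.fam y) := ⟨p.fn y, p.el y⟩

/-- Two representatives are identified when they agree on a set of the ultrafilter. -/
instance setoid (H : D → C → Type v) (S : Ultrafamily.{u} D) (T : Ultrafamily.{u} C) :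
    Setoid (PreGerm H S T) where
  r p q := ∀ᶠ y in (T.ult : Filter T.idx), p.val y = q.val y
  iseqv :=
    { refl := fun _ => Filter.Eventually.of_forall fun _ => rfl
      symm := fun h => h.mono fun _ e => e.symm
      trans := fun h h' => by filter_upwards [h, h'] with y e e' using e.trans e' }

end PreGerm

/-- Germs, modulo equality almost everywhere. -/
def Germ (H : D → C → Type v) (S : Ultrafamily.{u} D) (T : Ultrafamily.{u} C) :
    Type (max u v) :=
  Quotient (PreGerm.setoid H S T)

namespace PreGerm

variable {H : D → C → Type v} {S : Ultrafamily.{u} D} {T : Ultrafamily.{u} C}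

/-- The germ of a representative. -/
def germ (p : PreGerm H S T) : Germ H S T := Quotient.mk _ p

theorem germ_eq {p q : PreGerm H S T} :
    p.germ = q.germ ↔ ∀ᶠ y in (T.ult : Filter T.idx), p.val y = q.val y :=
  Quotient.eq

/-- Pointwise composition of representatives. -/
def comp {H' : C → B → Type v'} {H'' : D → B → Type v''} {U : Ultrafamily.{u} B}
    (m : ∀ d c b, H d c → H' c b → H'' d b) (p : PreGerm H S T) (q : PreGerm H' T U) :
    PreGerm H'' S U where
  fn z := p.fn (q.fn z)
  map_fn := by rw [← p.map_fn, ← q.map_fn, Ultrafilter.map_map]; rfl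
  el z := m _ _ _ (p.el (q.fn z)) (q.el z)

end PreGerm

namespace Germ

variable {H : D → C → Type v} {S : Ultrafamily.{u} D} {T : Ultrafamily.{u} C}

@[elab_as_elim]
theorem ind {motive : Germ H S T → Prop} (h : ∀ p : PreGerm H S T, motive p.germ)
    (x : Germ H S T) : motive x :=
  Quotient.ind h x

/-- A chosen representative of a germ. -/
noncomputable def out (x : Germ H S T) : PreGerm H S T := Quotient.out x

@[simp] theorem germ_out (x : Germ H S T) : x.out.germ = x := Quotient.out_eq x

theorem out_germ (p : PreGerm H S T) :
    ∀ᶠ y in (T.ult : Filter T.idx), p.germ.out.val y = p.val y :=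
  PreGerm.germ_eq.1 (germ_out p.germ)

/-- Pointwise composition of germs. -/
def comp {H' : C → B → Type v'} {H'' : D → B → Type v''} {U : Ultrafamily.{u} B}
    (m : ∀ d c b, H d c → H' c b → H'' d b) :
    Germ H S T → Germ H' T U → Germ H'' S U :=
  Quotient.map₂ (PreGerm.comp m) (by
    intro p p' hp q q' hq
    have hp' : ∀ᶠ z in (U.ult : Filter U.idx), p.val (q.fn z) = p'.val (q.fn z) := by
      have := q.map_fn
      have h2 : ∀ᶠ y in ((U.ult.map q.fn : Ultrafilter _) : Filter T.idx), p.val y = p'.val y := by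
        rw [this]; exact hp
      exact h2
    filter_upwards [hp', hq] with z h1 h2
    obtain ⟨f, hf, e⟩ := p
    obtain ⟨f', hf', e'⟩ := p'
    obtain ⟨g, hg, i⟩ := q
    obtain ⟨g', hg', i'⟩ := q'
    simp only [PreGerm.val, PreGerm.comp] at h1 h2 ⊢
    generalize hj : i z = j at h2 ⊢
    generalize hj' : i' z = j' at h2 ⊢
    clear hj hj'
    generalize g z = a at *
    generalize g' z = a' at *
    cases h2
    generalize e a = k at *
    generalize e' a = k' at *
    generalize f a = b at *
    generalize f' a = b' at *
    cases h1
    rfl)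

theorem comp_germ {H' : C → B → Type v'} {H'' : D → B → Type v''} {U : Ultrafamily.{u} B}
    (m : ∀ d c b, H d c → H' c b → H'' d b) (p : PreGerm H S T) (q : PreGerm H' T U) :
    comp m p.germ q.germ = (p.comp m q).germ := rfl

end Germ

/-! ### The category `β C` -/

section BetaCat

variable [Category.{u} B] [Category.{u} C] [Category.{u} D] [Category.{u} E]

/-- The hom-sets of `C` as a family of types. -/
abbrev homs (C : Type (u + 1)) [Category.{u} C] (c c' : C) : Type u := c ⟶ c'

/-- Pointwise composition in `C`. -/
abbrev homsComp (C : Type (u + 1)) [Category.{u} C] (c c' c'' : C) (f : homs C c c')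
    (g : homs C c' c'') : homs C c c'' := f ≫ g

/-- Representatives of arrows of `β C`. -/
abbrev PreHom (S T : Ultrafamily.{u} C) := PreGerm (homs C) S T

/-- The representative of an identity. -/
def PreHom.id (S : Ultrafamily.{u} C) : PreHom S S :=
  ⟨fun x => x, Ultrafilter.map_id S.ult, fun x => 𝟙 (S.fam x)⟩

/-- The category `β C` of ultrafamilies: an arrow `(X, h, ν) ⟶ (Y, k, ξ)` is represented by a
function `g : Y → X` with `g_* ξ = ν` together with arrows `h (g y) ⟶ k y` for all `y`; two
representatives are identified when they agree on a set belonging to `ξ`. -/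
instance : Category.{u} (Ultrafamily.{u} C) where
  Hom S T := Germ (homs C) S T
  id S := (PreHom.id S).germ
  comp p q := Germ.comp (homsComp C) p q
  id_comp {S T} p := by
    refine Germ.ind (fun p => ?_) p
    change ((PreHom.id S).comp (homsComp C) p).germ = p.germ
    congr 1; simp [PreGerm.comp, PreHom.id]
  comp_id {S T} p := by
    refine Germ.ind (fun p => ?_) p
    change (p.comp (homsComp C) (PreHom.id T)).germ = p.germ
    congr 1; simp [PreGerm.comp, PreHom.id]
  assoc p q r := by
    refine Germ.ind (fun p => ?_) p
    refine Germ.ind (fun q => ?_) q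
    refine Germ.ind (fun r => ?_) r
    change ((p.comp (homsComp C) q).comp (homsComp C) r).germ =
      (p.comp (homsComp C) (q.comp (homsComp C) r)).germ
    congr 1; simp [PreGerm.comp]

/-- The arrow of `β C` given by a representative. -/
def PreGerm.hom {S T : Ultrafamily.{u} C} (p : PreHom S T) : S ⟶ T := p.germ

/-- An arrow of `β C` as a germ. -/
def toGerm {S T : Ultrafamily.{u} C} (f : S ⟶ T) : Germ (homs C) S T := f

@[elab_as_elim]
theorem hom_ind {S T : Ultrafamily.{u} C} {motive : (S ⟶ T) → Prop}
    (h : ∀ p : PreHom S T, motive p.hom) (f : S ⟶ T) : motive f :=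
  Germ.ind (motive := motive) h f

theorem hom_comp {S T U : Ultrafamily.{u} C} (p : PreHom S T) (q : PreHom T U) :
    p.hom ≫ q.hom = (p.comp (homsComp C) q).hom := rfl

theorem hom_id (S : Ultrafamily.{u} C) : (PreHom.id S).hom = 𝟙 S := rfl

theorem hom_eq {S T : Ultrafamily.{u} C} {p q : PreHom S T} :
    p.hom = q.hom ↔ ∀ᶠ y in (T.ult : Filter T.idx), p.val y = q.val y := PreGerm.germ_eq

end BetaCat

/-! ### Functoriality of `β` -/

namespace Ultrafamily

/-- Application of a function to the members of an ultrafamily. -/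
def map (f : C → D) (S : Ultrafamily.{u} C) : Ultrafamily.{u} D := ⟨S.idx, fun x => f (S.fam x), S.ult⟩

/-- The one-element ultrafamily. -/
def unit (c : C) : Ultrafamily.{u} C := ⟨PUnit, fun _ => c, pure PUnit.unit⟩

/-- The direct sum `∑_{x : ν} ξ_x` of ultrafilters, on the disjoint union: a set `s` belongs to it
iff for `ν`-almost all `x` and `ξ_x`-almost all `y` one has `(x, y) ∈ s`. -/
def sumUlt {X : Type u} {Y : X → Type u} (ν : Ultrafilter X) (ξ : ∀ x, Ultrafilter (Y x)) :
    Ultrafilter (Σ x, Y x) :=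
  ν.bind fun x => (ξ x).map (Sigma.mk x)

theorem eventually_sumUlt {X : Type u} {Y : X → Type u} {ν : Ultrafilter X}
    {ξ : ∀ x, Ultrafilter (Y x)} {p : (Σ x, Y x) → Prop} :
    (∀ᶠ z in (sumUlt ν ξ : Filter _), p z) ↔
      ∀ᶠ x in (ν : Filter X), ∀ᶠ y in (ξ x : Filter (Y x)), p ⟨x, y⟩ := by
  rfl

/-- The sum of an ultrafamily of ultrafamilies. -/
def flatten (T : Ultrafamily.{u} (Ultrafamily.{u} C)) : Ultrafamily.{u} C where
  idx := Σ x : T.idx, (T.fam x).idx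
  fam z := (T.fam z.1).fam z.2
  ult := sumUlt T.ult fun x => (T.fam x).ult

end Ultrafamily

open Ultrafamily

/-- Equality of ultrafilters may be tested on one inclusion. -/
theorem ultrafilter_ext {X : Type u} {ν ξ : Ultrafilter X}
    (h : ∀ p : X → Prop, (∀ᶠ x in (ν : Filter X), p x) → ∀ᶠ x in (ξ : Filter X), p x) : ν = ξ := by
  symm
  apply Ultrafilter.coe_injective
  exact Ultrafilter.unique _ fun s hs => h (fun x => x ∈ s) hs

theorem map_sumUlt {X X' : Type u} {Y : X → Type u} {Y' : X' → Type u} {ν : Ultrafilter X}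
    {ν' : Ultrafilter X'} {ξ : ∀ x, Ultrafilter (Y x)} {ξ' : ∀ x, Ultrafilter (Y' x)}
    (g : X' → X) (hg : ν'.map g = ν) (k : ∀ x, Y' x → Y (g x))
    (hk : ∀ x, (ξ' x).map (k x) = ξ (g x)) :
    (sumUlt ν' ξ').map (fun z => (⟨g z.1, k z.1 z.2⟩ : Σ x, Y x)) = sumUlt ν ξ := by
  symm
  refine ultrafilter_ext fun p hp => ?_
  rw [eventually_sumUlt, ← hg] at hp
  change ∀ᶠ x in (ν' : Filter X'), ∀ᶠ y in (ξ (g x) : Filter _), p ⟨g x, y⟩ at hp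
  change ∀ᶠ z : (Σ x, Y' x) in (sumUlt ν' ξ' : Filter (Σ x, Y' x)), p ⟨g z.1, k z.1 z.2⟩
  rw [eventually_sumUlt]
  filter_upwards [hp] with x hx
  rw [← hk] at hx
  exact hx

namespace PreGerm

variable {H : D → C → Type v}

/-- Change of the elements and families, index sets and ultrafilters being kept. -/
def mapFam {H' : E → B → Type v'} {X Y : Type u} {ν : Ultrafilter X} {ξ : Ultrafilter Y}
    {h : X → D} {k : Y → C} {h' : X → E} {k' : Y → B}
    (φ : ∀ x y, H (h x) (k y) → H' (h' x) (k' y)) (p : PreGerm H ⟨X, h, ν⟩ ⟨Y, k, ξ⟩) :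
    PreGerm H' ⟨X, h', ν⟩ ⟨Y, k', ξ⟩ :=
  ⟨p.fn, p.map_fn, fun y => φ _ _ (p.el y)⟩

/-- The sum of a family of representatives along a map of index sets. -/
def sum {S : Ultrafamily.{u} (Ultrafamily.{u} D)} {T : Ultrafamily.{u} (Ultrafamily.{u} C)}
    (g : T.idx → S.idx) (hg : T.ult.map g = S.ult)
    (q : ∀ y, PreGerm H (S.fam (g y)) (T.fam y)) : PreGerm H S.flatten T.flatten where
  fn z := ⟨g z.1, (q z.1).fn z.2⟩
  map_fn := map_sumUlt (ξ := fun x => (S.fam x).ult) (ξ' := fun y => (T.fam y).ult) g hg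
    (fun y => (q y).fn) fun y => (q y).map_fn
  el z := (q z.1).el z.2

end PreGerm

namespace Germ

variable {H : D → C → Type v}

/-- Change of the elements and families, index sets and ultrafilters being kept. -/
def mapFam {H' : E → B → Type v'} {X Y : Type u} {ν : Ultrafilter X} {ξ : Ultrafilter Y}
    {h : X → D} {k : Y → C} {h' : X → E} {k' : Y → B}
    (φ : ∀ x y, H (h x) (k y) → H' (h' x) (k' y)) :
    Germ H ⟨X, h, ν⟩ ⟨Y, k, ξ⟩ → Germ H' ⟨X, h', ν⟩ ⟨Y, k', ξ⟩ :=
  Quotient.map (PreGerm.mapFam φ) (by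
    intro p q hpq
    refine hpq.mono fun y hy => ?_
    exact congrArg (fun a : Σ x, H (h x) (k y) => (⟨a.1, φ _ _ a.2⟩ : Σ x, H' (h' x) (k' y))) hy)

theorem mapFam_germ {H' : E → B → Type v'} {X Y : Type u} {ν : Ultrafilter X} {ξ : Ultrafilter Y}
    {h : X → D} {k : Y → C} {h' : X → E} {k' : Y → B}
    (φ : ∀ x y, H (h x) (k y) → H' (h' x) (k' y)) (p : PreGerm H ⟨X, h, ν⟩ ⟨Y, k, ξ⟩) :
    mapFam φ p.germ = (p.mapFam φ).germ := rfl

/-- The sum of a germ of germs. -/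
noncomputable def flatten {S : Ultrafamily.{u} (Ultrafamily.{u} D)}
    {T : Ultrafamily.{u} (Ultrafamily.{u} C)} (x : Germ (Germ H) S T) :
    Germ H S.flatten T.flatten :=
  (PreGerm.sum x.out.fn x.out.map_fn fun y => (x.out.el y).out).germ

/-- The sum of a germ of germs may be computed on arbitrary representatives. -/
theorem flatten_germ {S : Ultrafamily.{u} (Ultrafamily.{u} D)}
    {T : Ultrafamily.{u} (Ultrafamily.{u} C)} (p : PreGerm (Germ H) S T)
    (q : ∀ y, PreGerm H (S.fam (p.fn y)) (T.fam y)) (hq : ∀ y, (q y).germ = p.el y) :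
    flatten p.germ = (PreGerm.sum p.fn p.map_fn q).germ := by
  refine PreGerm.germ_eq.2 ?_
  change ∀ᶠ z in (sumUlt T.ult (fun x => (T.fam x).ult) : Filter (Σ x, (T.fam x).idx)), _
  rw [eventually_sumUlt]
  filter_upwards [out_germ p] with y hy
  have key : ∀ (a b : Σ x, Germ H (S.fam x) (T.fam y)) (_ : a = b)
      (q : PreGerm H (S.fam b.1) (T.fam y)) (_ : q.germ = b.2),
      ∀ᶠ z in ((T.fam y).ult : Filter _), (⟨⟨a.1, a.2.out.fn z⟩, a.2.out.el z⟩ :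
        Σ x : S.flatten.idx, H (S.flatten.fam x) ((T.fam y).fam z)) =
        ⟨⟨b.1, q.fn z⟩, q.el z⟩ := by
    rintro a _ rfl q hq
    rw [← germ_out a.2] at hq
    filter_upwards [PreGerm.germ_eq.1 hq] with z hz
    exact congrArg (fun c : Σ x, H ((S.fam a.1).fam x) ((T.fam y).fam z) =>
      (⟨⟨a.1, c.1⟩, c.2⟩ : Σ x : S.flatten.idx, H (S.flatten.fam x) ((T.fam y).fam z))) hz.symm
  exact key _ _ hy (q y) (hq y)

/-- Existence of simultaneous representatives of a germ of germs. -/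
@[elab_as_elim]
theorem ind₂ {S : Ultrafamily.{u} (Ultrafamily.{u} D)}
    {T : Ultrafamily.{u} (Ultrafamily.{u} C)} {motive : Germ (Germ H) S T → Prop}
    (h : ∀ (g : T.idx → S.idx) (hg : T.ult.map g = S.ult)
      (q : ∀ y, PreGerm H (S.fam (g y)) (T.fam y)),
      motive (PreGerm.germ ⟨g, hg, fun y => (q y).germ⟩)) (x : Germ (Germ H) S T) : motive x := by
  refine Germ.ind (fun p => ?_) x
  have := h p.fn p.map_fn fun y => (p.el y).out
  simpa only [germ_out] using this

theorem flatten_comp {H' : C → B → Type v'} {H'' : D → B → Type v''}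
    (m : ∀ d c b, H d c → H' c b → H'' d b) {S : Ultrafamily.{u} (Ultrafamily.{u} D)}
    {T : Ultrafamily.{u} (Ultrafamily.{u} C)} {U : Ultrafamily.{u} (Ultrafamily.{u} B)}
    (x : Germ (Germ H) S T) (y : Germ (Germ H') T U) :
    flatten (comp (H := Germ H) (H' := Germ H') (H'' := Germ H'') (fun _ _ _ => comp m) x y) = comp m (flatten x) (flatten y) := by
  refine Germ.ind₂ (fun g hg q => ?_) x
  refine Germ.ind₂ (fun g' hg' q' => ?_) y
  rw [comp_germ, flatten_germ ⟨g, hg, fun y => (q y).germ⟩ q (fun _ => rfl),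
    flatten_germ ⟨g', hg', fun y => (q' y).germ⟩ q' (fun _ => rfl),
    flatten_germ _ (fun z => (q (g' z)).comp m (q' z)) (fun _ => rfl)]
  rfl

end Germ

section BetaFunctor

variable [Category.{u} B] [Category.{u} C] [Category.{u} D] [Category.{u} E]

/-- The action of `β` on functors. -/
def beta (F : C ⥤ D) : Ultrafamily.{u} C ⥤ Ultrafamily.{u} D where
  obj S := S.map F.obj
  map f := Germ.mapFam (H' := homs D) (fun _ _ g => F.map g) (toGerm f)
  map_id S := by
    change (PreGerm.mapFam (H' := homs D) (fun _ _ g => F.map g) (PreHom.id S)).hom =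
      (PreHom.id _).hom
    congr 1; simp [PreGerm.mapFam, PreHom.id]
  map_comp {S T U} f g := by
    refine hom_ind (fun f => ?_) f
    refine hom_ind (fun g => ?_) g
    change (PreGerm.mapFam (H' := homs D) (h' := (S.map F.obj).fam) (k' := (U.map F.obj).fam)
      (fun _ _ g => F.map g) (f.comp (homsComp C) g)).hom = _
    simp [PreGerm.mapFam, PreGerm.comp]; rfl

/-- The unit `η_C : C ⥤ β C`. -/
def eta (C : Type (u + 1)) [Category.{u} C] : C ⥤ Ultrafamily.{u} C where
  obj c := unit c
  map f := PreGerm.hom ⟨fun x => x, Ultrafilter.map_id _, fun _ => f⟩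
  map_id _ := rfl
  map_comp _ _ := rfl

/-- The multiplication `μ_C : β β C ⥤ β C`. -/
noncomputable def mu (C : Type (u + 1)) [Category.{u} C] :
    Ultrafamily.{u} (Ultrafamily.{u} C) ⥤ Ultrafamily.{u} C where
  obj T := T.flatten
  map f := Germ.flatten (H := homs C) (toGerm f)
  map_id T := Germ.flatten_germ (H := homs C) (PreHom.id T)
      (fun x => PreHom.id (T.fam x)) (fun _ => rfl)
  map_comp f g := Germ.flatten_comp (homsComp C) (toGerm f) (toGerm g)

end BetaFunctor

/-! ### Profunctors, their 2-cells and their composition -/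

section Prof

variable [Category.{u} B] [Category.{u} C] [Category.{u} D] [Category.{u} E]

/-- The set `P(d, c)` for a profunctor `P : C ⇸ D`, i.e. `P : Dᵒᵖ × C → Type`. -/
abbrev El (P : Profunctor.{v} C D) (d : D) (c : C) : Type v := (P.obj c).obj (op d)

/-- The action `P(f, g) : P(d, c) → P(d', c')` for `f : d' ⟶ d` and `g : c ⟶ c'`. -/
def act (P : Profunctor.{v} C D) {d d' : D} {c c' : C} (f : d' ⟶ d) (g : c ⟶ c') (x : El P d c) :
    El P d' c' :=
  (P.map g).app (op d') ((P.obj c).map f.op x)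

@[simp] theorem act_id (P : Profunctor.{v} C D) {d : D} {c : C} (x : El P d c) :
    act P (𝟙 d) (𝟙 c) x = x := by
  simp [act]

theorem act_act (P : Profunctor.{v} C D) {d d' d'' : D} {c c' c'' : C} (f : d' ⟶ d) (g : c ⟶ c')
    (f' : d'' ⟶ d') (g' : c' ⟶ c'') (x : El P d c) :
    act P f' g' (act P f g x) = act P (f' ≫ f) (g ≫ g') x := by
  simp [act, NatTrans.naturality_apply]

/-- A profunctor from its sets of elements and its action. -/
def mkProf (X : D → C → Type v)
    (a : ∀ {d d' : D} {c c' : C} (_ : d' ⟶ d) (_ : c ⟶ c'), X d c → X d' c')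
    (a_id : ∀ d c (x : X d c), a (𝟙 d) (𝟙 c) x = x)
    (a_comp : ∀ {d d' d'' : D} {c c' c'' : C} (f : d' ⟶ d) (g : c ⟶ c') (f' : d'' ⟶ d')
      (g' : c' ⟶ c'') (x : X d c), a f' g' (a f g x) = a (f' ≫ f) (g ≫ g') x) :
    Profunctor.{v} C D :=
  Profunctor.ofCore
    { obj := fun c d => X d c
      map := fun g f => TypeCat.ofHom (a f g)
      map_id := fun c d => by ext x; exact a_id d c x
      map_comp := fun g g' f f' => by ext x; exact (a_comp f' g f g' x).symm }

theorem act_mkProf {X : D → C → Type v}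
    {a : ∀ {d d' : D} {c c' : C} (_ : d' ⟶ d) (_ : c ⟶ c'), X d c → X d' c'} {a_id a_comp}
    {d d' : D} {c c' : C} (f : d' ⟶ d) (g : c ⟶ c') (x : X d c) :
    act (mkProf X a a_id a_comp) f g x = a f g x := by
  change a (𝟙 d') g (a f (𝟙 c) x) = _
  rw [a_comp]; simp

/-- A profunctor `P : C ⇸ D` is small if every presheaf `P(-, c)` is a small colimit of
representables. -/
def IsSmallProf (P : Profunctor.{u} C D) : Prop :=
  ∀ c : C, ∃ (J : Type u) (_ : SmallCategory J) (G : J ⥤ D) (t : Limits.Cocone (G ⋙ yoneda)),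
    Nonempty (Limits.IsColimit t) ∧ Nonempty (t.pt ≅ P.obj c)

/-- A 2-cell between profunctors: a natural family of functions.  (The two profunctors may take
values in different universes.) -/
@[ext]
structure Cell (P : Profunctor.{v} C D) (Q : Profunctor.{v'} C D) where
  app : ∀ d c, El P d c → El Q d c
  naturality : ∀ {d d' : D} {c c' : C} (f : d' ⟶ d) (g : c ⟶ c') (x : El P d c),
    app d' c' (act P f g x) = act Q f g (app d c x)

/-- Vertical composition of 2-cells, in diagrammatic order. -/
def Cell.vcomp {P : Profunctor.{v} C D} {Q : Profunctor.{v'} C D} {R : Profunctor.{v''} C D}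
    (α : Cell P Q) (β : Cell Q R) : Cell P R :=
  ⟨fun d c x => β.app d c (α.app d c x), fun f g x => by rw [α.naturality, β.naturality]⟩

infixr:60 " ⋆ " => Cell.vcomp

/-- The identity 2-cell. -/
def Cell.id (P : Profunctor.{v} C D) : Cell P P := ⟨fun _ _ x => x, fun _ _ _ => rfl⟩

/-- The relation generating the coend `∫^d Q(e, d) × P(d, c)`. -/
inductive CompRel (Q : Profunctor.{v'} D E) (P : Profunctor.{v} C D) (e : E) (c : C) :
    (Σ d : D, El Q e d × El P d c) → (Σ d : D, El Q e d × El P d c) → Prop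
  | mk {d d' : D} (g : d ⟶ d') (q : El Q e d) (p : El P d' c) :
      CompRel Q P e c ⟨d', act Q (𝟙 e) g q, p⟩ ⟨d, q, act P g (𝟙 c) p⟩

/-- The elements `∫^d Q(e, d) × P(d, c)` of a composite of profunctors. -/
def CompEl (Q : Profunctor.{v'} D E) (P : Profunctor.{v} C D) (e : E) (c : C) :
    Type (max (u + 1) v v') :=
  Quot (CompRel Q P e c)

/-- The class of a pair in a composite of profunctors. -/
def tens {Q : Profunctor.{v'} D E} {P : Profunctor.{v} C D} {e : E} {c : C} (d : D) (q : El Q e d)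
    (p : El P d c) : CompEl Q P e c :=
  Quot.mk _ ⟨d, q, p⟩

theorem tens_bal {Q : Profunctor.{v'} D E} {P : Profunctor.{v} C D} {e : E} {c : C} {d d' : D}
    (g : d ⟶ d') (q : El Q e d) (p : El P d' c) :
    tens (Q := Q) d' (act Q (𝟙 e) g q) p = tens d q (act P g (𝟙 c) p) :=
  Quot.sound ⟨g, q, p⟩

/-- Functions out of a coend. -/
def CompEl.lift {Q : Profunctor.{v'} D E} {P : Profunctor.{v} C D} {e : E} {c : C} {X : Type w}
    (φ : ∀ d, El Q e d → El P d c → X)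
    (h : ∀ {d d'} (g : d ⟶ d') q p, φ d' (act Q (𝟙 e) g q) p = φ d q (act P g (𝟙 c) p)) :
    CompEl Q P e c → X :=
  Quot.lift (fun t => φ t.1 t.2.1 t.2.2) (by rintro _ _ ⟨g, q, p⟩; exact h g q p)

@[elab_as_elim]
theorem CompEl.ind {Q : Profunctor.{v'} D E} {P : Profunctor.{v} C D} {e : E} {c : C}
    {motive : CompEl Q P e c → Prop} (h : ∀ d q p, motive (tens d q p)) (x : CompEl Q P e c) :
    motive x :=
  Quot.ind (fun t => h t.1 t.2.1 t.2.2) x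

/-- Composition of profunctors `P : C ⇸ D` and `Q : D ⇸ E`, by the coend formula
`(Q ∘ P)(e, c) = ∫^d Q(e, d) × P(d, c)`. -/
def pcomp (Q : Profunctor.{v'} D E) (P : Profunctor.{v} C D) :
    Profunctor.{max (u + 1) v v'} C E :=
  mkProf (CompEl Q P)
    (fun {_ _ _ _} f g => CompEl.lift (fun d q p => tens d (act Q f (𝟙 d) q) (act P (𝟙 d) g p))
      (fun {d d'} k q p => by
        rw [act_act]
        have := tens_bal (Q := Q) (P := P) k (act Q f (𝟙 d) q) (act P (𝟙 d') g p)
        rw [act_act, act_act] at this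
        simp only [Category.id_comp, Category.comp_id] at this ⊢
        rw [this, act_act]
        simp))
    (fun e c x => by
      refine CompEl.ind (fun d q p => ?_) x
      change tens d _ _ = _
      rw [act_id, act_id])
    (fun f g f' g' x => by
      refine CompEl.ind (fun d q p => ?_) x
      change tens d _ _ = tens d _ _
      rw [act_act, act_act]; simp)

infixr:80 " ⊙ " => pcomp

/-- The class of a pair, as an element of the composite profunctor. -/
def tmk {Q : Profunctor.{v'} D E} {P : Profunctor.{v} C D} {e : E} {c : C} (d : D) (q : El Q e d)
    (p : El P d c) : El (Q ⊙ P) e c :=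
  tens d q p

theorem tmk_bal {Q : Profunctor.{v'} D E} {P : Profunctor.{v} C D} {e : E} {c : C} {d d' : D}
    (g : d ⟶ d') (q : El Q e d) (p : El P d' c) :
    tmk (Q := Q) d' (act Q (𝟙 e) g q) p = tmk d q (act P g (𝟙 c) p) :=
  tens_bal g q p

theorem act_tmk {Q : Profunctor.{v'} D E} {P : Profunctor.{v} C D} {e e' : E} {c c' : C}
    (f : e' ⟶ e) (g : c ⟶ c') (d : D) (q : El Q e d) (p : El P d c) :
    act (Q ⊙ P) f g (tmk d q p) = tmk d (act Q f (𝟙 d) q) (act P (𝟙 d) g p) :=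
  act_mkProf _ _ _

@[elab_as_elim]
theorem tmk_ind {Q : Profunctor.{v'} D E} {P : Profunctor.{v} C D} {e : E} {c : C}
    {motive : El (Q ⊙ P) e c → Prop} (h : ∀ d q p, motive (tmk d q p)) (x : El (Q ⊙ P) e c) :
    motive x :=
  CompEl.ind (motive := motive) h x

/-- Functions out of the elements of a composite profunctor. -/
def tlift {Q : Profunctor.{v'} D E} {P : Profunctor.{v} C D} {e : E} {c : C} {X : Type w}
    (φ : ∀ d, El Q e d → El P d c → X)
    (h : ∀ {d d'} (g : d ⟶ d') q p, φ d' (act Q (𝟙 e) g q) p = φ d q (act P g (𝟙 c) p)) :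
    El (Q ⊙ P) e c → X :=
  CompEl.lift φ h

@[simp] theorem tlift_tmk {Q : Profunctor.{v'} D E} {P : Profunctor.{v} C D} {e : E} {c : C}
    {X : Type w} (φ : ∀ d, El Q e d → El P d c → X)
    (h : ∀ {d d'} (g : d ⟶ d') q p, φ d' (act Q (𝟙 e) g q) p = φ d q (act P g (𝟙 c) p))
    (d : D) (q : El Q e d) (p : El P d c) : tlift φ h (tmk d q p) = φ d q p := rfl

/-- A 2-cell out of a composite of profunctors. -/
def Cell.ofComp {Q : Profunctor.{v'} D E} {P : Profunctor.{v} C D} {R : Profunctor.{w} C E}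
    (φ : ∀ e c d, El Q e d → El P d c → El R e c)
    (bal : ∀ {e c d d'} (g : d ⟶ d') q p,
      φ e c d' (act Q (𝟙 e) g q) p = φ e c d q (act P g (𝟙 c) p))
    (nat : ∀ {e e' c c' d} (f : e' ⟶ e) (g : c ⟶ c') (q : El Q e d) (p : El P d c),
      φ e' c' d (act Q f (𝟙 d) q) (act P (𝟙 d) g p) = act R f g (φ e c d q p)) :
    Cell (Q ⊙ P) R where
  app e c := tlift (φ e c) bal
  naturality f g x := by
    refine tmk_ind (fun d q p => ?_) x
    rw [act_tmk]
    exact nat f g q p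

@[simp] theorem Cell.ofComp_tmk {Q : Profunctor.{v'} D E} {P : Profunctor.{v} C D}
    {R : Profunctor.{w} C E} (φ : ∀ e c d, El Q e d → El P d c → El R e c) (bal) (nat) (e : E)
    (c : C) (d : D) (q : El Q e d) (p : El P d c) :
    (Cell.ofComp (R := R) φ bal nat).app e c (tmk d q p) = φ e c d q p := rfl

/-- Whiskering `Q ∘ α`. -/
def whL (Q : Profunctor.{w} D E) {P : Profunctor.{v} C D} {P' : Profunctor.{v'} C D}
    (α : Cell P P') : Cell (Q ⊙ P) (Q ⊙ P') :=
  Cell.ofComp (fun _ c d q p => tmk d q (α.app d c p))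
    (fun g q p => by rw [tmk_bal, α.naturality])
    (fun f g q p => by rw [act_tmk, α.naturality])

/-- Whiskering `α ∘ P`. -/
def whR {Q : Profunctor.{v} D E} {Q' : Profunctor.{v'} D E} (α : Cell Q Q')
    (P : Profunctor.{w} C D) : Cell (Q ⊙ P) (Q' ⊙ P) :=
  Cell.ofComp (fun e _ d q p => tmk d (α.app e d q) p)
    (fun g q p => by rw [α.naturality, tmk_bal])
    (fun f g q p => by rw [act_tmk, α.naturality])

/-- The associator `(R ∘ Q) ∘ P ⇒ R ∘ (Q ∘ P)`. -/
def assocHom (R : Profunctor.{w} D E) (Q : Profunctor.{v'} C D) (P : Profunctor.{v} B C) :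
    Cell ((R ⊙ Q) ⊙ P) (R ⊙ Q ⊙ P) :=
  Cell.ofComp
    (fun _ _ c x p => tlift (fun d r q => tmk d r (tmk c q p))
      (fun g r q => by rw [tmk_bal, act_tmk, act_id]) x)
    (fun g x p => by
      refine tmk_ind (fun d r q => ?_) x
      rw [act_tmk, act_id R, tlift_tmk, tlift_tmk, tmk_bal])
    (fun f g x p => by
      refine tmk_ind (fun d r q => ?_) x
      rw [act_tmk, act_id Q, tlift_tmk, tlift_tmk, act_tmk, act_tmk, act_id Q])

/-- The inverse associator `R ∘ (Q ∘ P) ⇒ (R ∘ Q) ∘ P`. -/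
def assocInv (R : Profunctor.{w} D E) (Q : Profunctor.{v'} C D) (P : Profunctor.{v} B C) :
    Cell (R ⊙ Q ⊙ P) ((R ⊙ Q) ⊙ P) :=
  Cell.ofComp
    (fun _ _ d r x => tlift (fun c q p => tmk c (tmk d r q) p)
      (fun g q p => by rw [← tmk_bal, act_tmk, act_id]) x)
    (fun g r x => by
      refine tmk_ind (fun c q p => ?_) x
      rw [act_tmk, act_id P, tlift_tmk, tlift_tmk, tmk_bal])
    (fun f g r x => by
      refine tmk_ind (fun c q p => ?_) x
      rw [act_tmk, act_id Q, tlift_tmk, tlift_tmk, act_tmk, act_tmk, act_id Q])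

/-! ### Graphs of functors -/

/-- The graph `f_⋄ : C ⇸ D` of a functor `f : C ⥤ D`, given by `f_⋄ (d, c) = D(d, f c)`. -/
def graph (F : C ⥤ D) : Profunctor.{u} C D := F.toProfunctor

/-- An arrow `d ⟶ f c` as an element of `f_⋄ (d, c)`. -/
def gmk (F : C ⥤ D) {d : D} {c : C} (x : d ⟶ F.obj c) : El (graph F) d c := x

/-- An element of `f_⋄ (d, c)` as an arrow `d ⟶ f c`. -/
def garr {F : C ⥤ D} {d : D} {c : C} (x : El (graph F) d c) : d ⟶ F.obj c := x

@[simp] theorem garr_gmk (F : C ⥤ D) {d : D} {c : C} (x : d ⟶ F.obj c) : garr (gmk F x) = x := rfl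

@[simp] theorem gmk_garr {F : C ⥤ D} {d : D} {c : C} (x : El (graph F) d c) :
    gmk F (garr x) = x := rfl

theorem act_gmk (F : C ⥤ D) {d d' : D} {c c' : C} (f : d' ⟶ d) (g : c ⟶ c') (x : d ⟶ F.obj c) :
    act (graph F) f g (gmk F x) = gmk F (f ≫ x ≫ F.map g) := by
  change ((f ≫ x) ≫ F.map g) = f ≫ x ≫ F.map g
  simp

theorem garr_act (F : C ⥤ D) {d d' : D} {c c' : C} (f : d' ⟶ d) (g : c ⟶ c')
    (x : El (graph F) d c) : garr (act (graph F) f g x) = f ≫ garr x ≫ F.map g := by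
  rw [← gmk_garr x, act_gmk]; rfl

/-- The identity profunctor `C ⇸ C`, given by the hom-sets of `C`. -/
abbrev one (C : Type (u + 1)) [Category.{u} C] : Profunctor.{u} C C := graph (𝟭 C)

/-- The left unitor `1 ∘ P ⇒ P`. -/
def lunit (P : Profunctor.{v} C D) : Cell (one D ⊙ P) P :=
  Cell.ofComp (fun _ c _ f p => act P (garr f) (𝟙 c) p)
    (fun g f p => by rw [garr_act, act_act]; simp)
    (fun f g h p => by rw [garr_act, act_act, act_act]; simp)

/-- The inverse left unitor `P ⇒ 1 ∘ P`. -/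
def lunitInv (P : Profunctor.{v} C D) : Cell P (one D ⊙ P) where
  app d _ p := tmk d (gmk (𝟭 D) (𝟙 d)) p
  naturality {d d' c c'} f g p := by
    have h1 : act P f g p = act P f (𝟙 c') (act P (𝟙 d) g p) := by rw [act_act]; simp
    rw [act_tmk, h1, ← tmk_bal f, act_gmk, act_gmk]; simp

/-- The right unitor `P ∘ 1 ⇒ P`. -/
def runit (P : Profunctor.{v} C D) : Cell (P ⊙ one C) P :=
  Cell.ofComp (fun d _ _ p f => act P (𝟙 d) (garr f) p)
    (fun g p f => by rw [garr_act, act_act]; simp)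
    (fun f g p h => by rw [garr_act, act_act, act_act]; simp)

/-- The inverse right unitor `P ⇒ P ∘ 1`. -/
def runitInv (P : Profunctor.{v} C D) : Cell P (P ⊙ one C) where
  app _ c p := tmk c p (gmk (𝟭 C) (𝟙 c))
  naturality {d d' c c'} f g p := by
    have h1 : act P f g p = act P (𝟙 d') g (act P f (𝟙 c) p) := by rw [act_act]; simp
    rw [act_tmk, h1, tmk_bal g, act_gmk, act_gmk]; simp

/-- The 2-cell `f_⋄ ⇒ g_⋄` of a natural transformation. -/
def graphMap {F G : C ⥤ D} (α : F ⟶ G) : Cell (graph F) (graph G) where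
  app d c x := gmk G (garr x ≫ α.app c)
  naturality f g x := by
    rw [garr_act, act_gmk]; simp

/-- The comparison `g_⋄ ∘ f_⋄ ⇒ (g f)_⋄`. -/
def graphComp (F : C ⥤ D) (G : D ⥤ E) : Cell (graph G ⊙ graph F) (graph (F ⋙ G)) :=
  Cell.ofComp (fun e c d x y => gmk (F ⋙ G) (garr x ≫ G.map (garr y)))
    (fun g q p => by rw [garr_act, garr_act]; simp)
    (fun f g q p => by rw [garr_act, garr_act, act_gmk]; simp)

/-- The inverse comparison `(g f)_⋄ ⇒ g_⋄ ∘ f_⋄`. -/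
def graphCompInv (F : C ⥤ D) (G : D ⥤ E) : Cell (graph (F ⋙ G)) (graph G ⊙ graph F) where
  app e c x := tmk (F.obj c) (gmk G (garr (F := F ⋙ G) x)) (gmk F (𝟙 (F.obj c)))
  naturality {d d' c c'} f g x := by
    have h1 : gmk G (garr (F := F ⋙ G) (act (graph (F ⋙ G)) f g x)) =
        act (graph G) (𝟙 _) (F.map g) (act (graph G) f (𝟙 _) (gmk G (garr (F := F ⋙ G) x))) := by
      rw [garr_act, act_gmk, act_gmk]; simp
    rw [act_tmk, h1, tmk_bal, act_gmk F, act_gmk F]; simp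

/-- Evaluation `(P ∘ f_⋄)(e, c) → P(e, f c)`. -/
def evalGraph {P : Profunctor.{v} D E} {F : C ⥤ D} {e : E} {c : C} :
    El (P ⊙ graph F) e c → El P e (F.obj c) :=
  tlift (fun _ p f => act P (𝟙 e) (garr f) p)
    (fun g p f => by rw [garr_act, act_act]; simp)

theorem evalGraph_tmk {P : Profunctor.{v} D E} {F : C ⥤ D} {e : E} {c : C} (d : D) (p : El P e d)
    (f : El (graph F) d c) : evalGraph (tmk d p f) = act P (𝟙 e) (garr f) p := rfl

theorem evalGraph_act {P : Profunctor.{v} D E} {F : C ⥤ D} {e e' : E} {c c' : C} (f : e' ⟶ e)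
    (g : c ⟶ c') (x : El (P ⊙ graph F) e c) :
    evalGraph (act (P ⊙ graph F) f g x) = act P f (F.map g) (evalGraph x) := by
  refine tmk_ind (fun d p h => ?_) x
  rw [act_tmk, evalGraph_tmk, evalGraph_tmk, garr_act, act_act, act_act]; simp

/-! ### The action of `β` on profunctors -/

/-- The action of `β` on profunctors.  For ultrafamilies `S = (X, h, ν)` in `D` and
`T = (Y, k, ξ)` in `C`, the elements of `(β P)(S, T)` are represented by a function `g : Y → X`
with `g_* ξ = ν` and a family of elements of `P(h (g y), k y)`, modulo equality `ξ`-almost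
everywhere; so `β` of a hom-profunctor is the hom-profunctor of `β C`.  -/
def betaProf (P : Profunctor.{v} C D) : Profunctor.{max u v} (Ultrafamily.{u} C) (Ultrafamily.{u} D) :=
  mkProf (fun S T => Germ (El P) S T)
    (fun f g x => Germ.comp (H := homs D) (H' := El P) (fun _ _ c f x => act P f (𝟙 c) x) (toGerm f)
      (Germ.comp (H := El P) (H' := homs C) (fun d _ _ x g => act P (𝟙 d) g x) x (toGerm g)))
    (fun S T x => by
      refine Germ.ind (fun p => ?_) x
      refine congrArg PreGerm.germ ?_
      simp [PreGerm.comp, PreHom.id])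
    (fun f g f' g' x => by
      refine Germ.ind (fun p => ?_) x
      refine hom_ind (fun f => ?_) f
      refine hom_ind (fun f' => ?_) f'
      refine hom_ind (fun g => ?_) g
      refine hom_ind (fun g' => ?_) g'
      refine congrArg PreGerm.germ ?_
      simp [PreGerm.comp, act_act])

/-- A germ as an element of `β P`. -/
def bmk {P : Profunctor.{v} C D} {S : Ultrafamily.{u} D} {T : Ultrafamily.{u} C}
    (x : Germ (El P) S T) : El (betaProf P) S T := x

/-- An element of `β P` as a germ. -/
def bgerm {P : Profunctor.{v} C D} {S : Ultrafamily.{u} D} {T : Ultrafamily.{u} C}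
    (x : El (betaProf P) S T) : Germ (El P) S T := x

/-- The element of `β P` given by a representative. -/
def PreGerm.el' {P : Profunctor.{v} C D} {S : Ultrafamily.{u} D} {T : Ultrafamily.{u} C}
    (p : PreGerm (El P) S T) : El (betaProf P) S T := bmk p.germ

end Prof

theorem germ_congr {H : D → C → Type v} {S : Ultrafamily.{u} D} {T : Ultrafamily.{u} C}
    {f : T.idx → S.idx} {hf hf' : T.ult.map f = S.ult} {e e' : ∀ y, H (S.fam (f y)) (T.fam y)}
    (h : ∀ y, e y = e' y) :
    PreGerm.germ (⟨f, hf, e⟩ : PreGerm H S T) = PreGerm.germ ⟨f, hf', e'⟩ := by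
  cases funext h; rfl

section Prof2
variable [Category.{u} B] [Category.{u} C] [Category.{u} D] [Category.{u} E]

@[elab_as_elim]
theorem el_ind {P : Profunctor.{v} C D} {S : Ultrafamily.{u} D} {T : Ultrafamily.{u} C}
    {motive : El (betaProf P) S T → Prop} (h : ∀ p : PreGerm (El P) S T, motive p.el')
    (x : El (betaProf P) S T) : motive x :=
  Germ.ind (motive := motive) h x

/-- The action of representatives of arrows on a representative of an element. -/
def PreGerm.actEl {P : Profunctor.{v} C D} {S S' : Ultrafamily.{u} D} {T T' : Ultrafamily.{u} C}
    (f : PreHom S' S) (g : PreHom T T') (p : PreGerm (El P) S T) : PreGerm (El P) S' T' where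
  fn y := f.fn (p.fn (g.fn y))
  map_fn := by rw [← f.map_fn, ← p.map_fn, ← g.map_fn, Ultrafilter.map_map, Ultrafilter.map_map]; rfl
  el y := act P (f.el _) (g.el y) (p.el _)

theorem act_el' {P : Profunctor.{v} C D} {S S' : Ultrafamily.{u} D} {T T' : Ultrafamily.{u} C}
    (f : PreHom S' S) (g : PreHom T T') (p : PreGerm (El P) S T) :
    act (betaProf P) f.hom g.hom p.el' = (PreGerm.actEl f g p).el' := by
  refine (act_mkProf _ _ _).trans ?_
  refine congrArg PreGerm.germ ?_
  simp [PreGerm.comp, PreGerm.actEl, act_act]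

theorem el'_eq {P : Profunctor.{v} C D} {S : Ultrafamily.{u} D} {T : Ultrafamily.{u} C}
    {p q : PreGerm (El P) S T} :
    p.el' = q.el' ↔ ∀ᶠ y in (T.ult : Filter T.idx), p.val y = q.val y := PreGerm.germ_eq

/-- The action of `β` on 2-cells between profunctors. -/
def betaCell {P : Profunctor.{v} C D} {Q : Profunctor.{v'} C D} (α : Cell P Q) :
    Cell (betaProf P) (betaProf Q) where
  app _ _ x := bmk (Germ.mapFam (fun _ _ => α.app _ _) (bgerm x))
  naturality f g x := by
    refine hom_ind (fun f => ?_) f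
    refine hom_ind (fun g => ?_) g
    refine el_ind (fun p => ?_) x
    rw [act_el']
    change _ = act (betaProf Q) f.hom g.hom (PreGerm.el' (p.mapFam (h := _) (fun _ _ => α.app _ _)))
    rw [act_el']
    refine congrArg PreGerm.germ ?_
    simp [PreGerm.mapFam, PreGerm.actEl, α.naturality]

theorem betaCell_el' {P : Profunctor.{v} C D} {Q : Profunctor.{v'} C D} (α : Cell P Q)
    {S : Ultrafamily.{u} D} {T : Ultrafamily.{u} C} (p : PreGerm (El P) S T) :
    (betaCell α).app S T p.el' = PreGerm.el' ⟨p.fn, p.map_fn, fun y => α.app _ _ (p.el y)⟩ := rfl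

/-- The comparison `β Q ∘ β P ⇒ β (Q ∘ P)`. -/
def betaComp (Q : Profunctor.{v'} D E) (P : Profunctor.{v} C D) :
    Cell (betaProf Q ⊙ betaProf P) (betaProf (Q ⊙ P)) :=
  Cell.ofComp (fun _ _ _ q p => bmk (Germ.comp (H'' := El (Q ⊙ P)) (fun _ d _ q p => tmk d q p) (bgerm q) (bgerm p)))
    (fun {S U T T'} g q p => by
      refine hom_ind (fun g => ?_) g
      refine el_ind (fun q => ?_) q
      refine el_ind (fun p => ?_) p
      rw [← hom_id, ← hom_id, act_el', act_el']
      refine congrArg PreGerm.germ ?_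
      simp [PreGerm.actEl, PreGerm.comp, PreHom.id, tmk_bal])
    (fun {S S' U U' T} f g q p => by
      refine hom_ind (fun f => ?_) f
      refine hom_ind (fun g => ?_) g
      refine el_ind (fun q => ?_) q
      refine el_ind (fun p => ?_) p
      rw [← hom_id, act_el', act_el']
      change _ = act (betaProf (Q ⊙ P)) f.hom g.hom (PreGerm.el' (q.comp (H'' := El (Q ⊙ P)) (fun _ d _ q p => tmk d q p) p))
      rw [act_el']
      refine congrArg PreGerm.germ ?_
      simp [PreGerm.actEl, PreGerm.comp, PreHom.id, act_tmk])

theorem betaComp_el' (Q : Profunctor.{v'} D E) (P : Profunctor.{v} C D) {S : Ultrafamily.{u} E}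
    {T : Ultrafamily.{u} D} {U : Ultrafamily.{u} C} (q : PreGerm (El Q) S T)
    (p : PreGerm (El P) T U) :
    (betaComp Q P).app S U (tmk T q.el' p.el') =
      PreGerm.el' (q.comp (H'' := El (Q ⊙ P)) (fun _ d _ q p => tmk d q p) p) := rfl

/-- The action of `β f` on representatives of arrows. -/
def PreGerm.bmap (F : C ⥤ D) {S T : Ultrafamily.{u} C} (p : PreHom S T) :
    PreHom ((beta F).obj S) ((beta F).obj T) :=
  ⟨p.fn, p.map_fn, fun y => F.map (p.el y)⟩

theorem beta_map_hom (F : C ⥤ D) {S T : Ultrafamily.{u} C} (p : PreHom S T) :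
    (beta F).map p.hom = (p.bmap F).hom := rfl

/-- Representatives of elements of `β (f_⋄)` as representatives of arrows. -/
def PreGerm.ofGraph {F : C ⥤ D} {S : Ultrafamily.{u} D} {T : Ultrafamily.{u} C}
    (p : PreGerm (El (graph F)) S T) : PreHom S ((beta F).obj T) :=
  ⟨p.fn, p.map_fn, fun y => garr (p.el y)⟩

/-- Representatives of arrows as representatives of elements of `β (f_⋄)`. -/
def PreGerm.toGraph (F : C ⥤ D) {S : Ultrafamily.{u} D} {T : Ultrafamily.{u} C}
    (p : PreHom S ((beta F).obj T)) : PreGerm (El (graph F)) S T :=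
  ⟨p.fn, p.map_fn, fun y => gmk F (p.el y)⟩

/-- The identification `β (f_⋄) ⇒ (β f)_⋄`. -/
def betaGraph (F : C ⥤ D) : Cell (betaProf (graph F)) (graph (beta F)) where
  app S T x := gmk (beta F) (d := S) (c := T) (Germ.mapFam (H' := homs D) (h' := S.fam)
    (k' := (T.map F.obj).fam) (fun _ _ x => garr x) (bgerm x))
  naturality {S S' T T'} f g x := by
    refine hom_ind (fun f => ?_) f
    refine hom_ind (fun g => ?_) g
    refine el_ind (fun p => ?_) x
    rw [act_el']
    change gmk (beta F) (PreGerm.hom (PreGerm.ofGraph (PreGerm.actEl f g p))) =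
      act (graph (beta F)) f.hom g.hom (gmk (beta F) (PreGerm.hom (PreGerm.ofGraph p)))
    rw [act_gmk, beta_map_hom, hom_comp, hom_comp]
    exact germ_congr (fun y => garr_act _ _ _ _)

theorem betaGraph_el' (F : C ⥤ D) {S : Ultrafamily.{u} D} {T : Ultrafamily.{u} C}
    (p : PreGerm (El (graph F)) S T) :
    (betaGraph F).app S T p.el' = gmk (beta F) p.ofGraph.hom := rfl

/-- The identification `(β f)_⋄ ⇒ β (f_⋄)`. -/
def betaGraphInv (F : C ⥤ D) : Cell (graph (beta F)) (betaProf (graph F)) where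
  app S T x := bmk (Germ.mapFam (H := homs D) (h := S.fam)
    (k := (T.map F.obj).fam) (H' := El (graph F)) (h' := S.fam) (k' := T.fam)
    (fun _ _ x => gmk F x) (toGerm (garr x)))
  naturality {S S' T T'} f g x := by
    refine hom_ind (fun f => ?_) f
    refine hom_ind (fun g => ?_) g
    rw [← gmk_garr x, act_gmk, beta_map_hom]
    generalize garr x = y
    refine hom_ind (fun p => ?_) y
    rw [hom_comp, hom_comp]
    change PreGerm.el' (PreGerm.toGraph F (PreGerm.comp (homsComp D) f (PreGerm.comp (homsComp D) p
      (g.bmap F)))) = act (betaProf (graph F)) f.hom g.hom (PreGerm.el' (PreGerm.toGraph F p))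
    rw [act_el']
    exact germ_congr (fun y => (act_gmk F _ _ _).symm)

theorem betaGraphInv_hom (F : C ⥤ D) {S : Ultrafamily.{u} D} {T : Ultrafamily.{u} C}
    (p : PreHom S ((beta F).obj T)) :
    (betaGraphInv F).app S T (gmk (beta F) p.hom) = (p.toGraph F).el' := rfl

theorem betaGraph_betaGraphInv (F : C ⥤ D) : betaGraph F ⋆ betaGraphInv F = Cell.id _ := by
  ext S T x
  refine el_ind (fun p => ?_) x
  rfl

theorem betaGraphInv_betaGraph (F : C ⥤ D) : betaGraphInv F ⋆ betaGraph F = Cell.id _ := by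
  ext S T x
  rw [← gmk_garr x]
  generalize garr x = y
  refine hom_ind (fun p => ?_) y
  rfl

/-- Pointwise evaluation of representatives. -/
def PreGerm.evalG {P : Profunctor.{v} D E} {G : C ⥤ D} {S : Ultrafamily.{u} E}
    {T : Ultrafamily.{u} C} (p : PreGerm (El (P ⊙ graph G)) S T) :
    PreGerm (El P) S ((beta G).obj T) :=
  ⟨p.fn, p.map_fn, fun y => evalGraph (p.el y)⟩

/-- The inverse comparison `β (P ∘ g_⋄) ⇒ β P ∘ (β g)_⋄` at the graph of a functor. -/
def compRep (P : Profunctor.{v} D E) (G : C ⥤ D) :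
    Cell (betaProf (P ⊙ graph G)) (betaProf P ⊙ graph (beta G)) where
  app S T x := tmk ((beta G).obj T)
    (bmk (Germ.mapFam (H := El (P ⊙ graph G)) (h := S.fam) (k := T.fam) (H' := El P) (h' := S.fam)
      (k' := (T.map G.obj).fam) (fun _ _ x => evalGraph x) (bgerm x)))
    (gmk (beta G) (𝟙 _))
  naturality {S S' T T'} f g x := by
    rw [act_tmk, act_gmk]
    have h1 : 𝟙 ((beta G).obj T) ≫ 𝟙 ((beta G).obj T) ≫ (beta G).map g =
      (beta G).map g ≫ 𝟙 ((beta G).obj T') ≫ (beta G).map (𝟙 T') := by simp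
    rw [h1, ← act_gmk, ← tmk_bal, act_act]
    congr 1
    simp only [Category.id_comp]
    refine hom_ind (fun f => ?_) f
    refine hom_ind (fun g => ?_) g
    refine el_ind (fun p => ?_) x
    rw [act_el']
    change _ = act (betaProf P) f.hom (PreGerm.hom (PreGerm.bmap G g)) (PreGerm.el' p.evalG)
    rw [act_el']
    refine congrArg PreGerm.germ ?_
    simp [PreGerm.mapFam, PreGerm.actEl, PreGerm.evalG, PreGerm.bmap, evalGraph_act]
    rfl

theorem compRep_el' (P : Profunctor.{v} D E) (G : C ⥤ D) {S : Ultrafamily.{u} E}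
    {T : Ultrafamily.{u} C} (p : PreGerm (El (P ⊙ graph G)) S T) :
    (compRep P G).app S T p.el' = tmk ((beta G).obj T) p.evalG.el' (gmk (beta G) (𝟙 _)) := rfl

theorem evalGraph_inv {P : Profunctor.{v} D E} {G : C ⥤ D} {e : E} {c : C}
    (x : El (P ⊙ graph G) e c) : tmk (G.obj c) (evalGraph x) (gmk G (𝟙 _)) = x := by
  refine tmk_ind (fun d p f => ?_) x
  rw [evalGraph_tmk, tmk_bal, act_gmk]; simp

/-- The comparison `β P ∘ (β g)_⋄ ⇒ β (P ∘ g_⋄)`. -/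
abbrev betaCompGraph (P : Profunctor.{v} D E) (G : C ⥤ D) :
    Cell (betaProf P ⊙ graph (beta G)) (betaProf (P ⊙ graph G)) :=
  whL (betaProf P) (betaGraphInv G) ⋆ betaComp P (graph G)

theorem compRep_betaCompGraph (P : Profunctor.{v} D E) (G : C ⥤ D) :
    compRep P G ⋆ betaCompGraph P G = Cell.id _ := by
  ext S T x
  refine el_ind (fun p => ?_) x
  change PreGerm.el' (PreGerm.comp (H'' := El (P ⊙ graph G)) (fun _ d _ q p => tmk d q p) p.evalG
    ((PreHom.id ((beta G).obj T)).toGraph G)) = p.el'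
  refine congrArg PreGerm.germ ?_
  obtain ⟨f, h, e⟩ := p
  simp only [PreGerm.comp, PreGerm.evalG, PreGerm.toGraph, PreHom.id]
  congr
  funext y
  exact evalGraph_inv (e y)

theorem betaCompGraph_compRep (P : Profunctor.{v} D E) (G : C ⥤ D) :
    betaCompGraph P G ⋆ compRep P G = Cell.id _ := by
  ext S U x
  refine tmk_ind (fun T p f => ?_) x
  refine el_ind (fun p => ?_) p
  rw [← gmk_garr f]
  generalize garr f = f
  refine hom_ind (fun f => ?_) f
  have h1 : PreGerm.hom f = PreGerm.hom f ≫ 𝟙 ((beta G).obj U) ≫ (beta G).map (𝟙 U) := by simp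
  change tmk ((beta G).obj U) (PreGerm.el' (PreGerm.evalG (PreGerm.comp (H'' := El (P ⊙ graph G))
    (fun _ d _ q p => tmk d q p) p (PreGerm.toGraph G f)))) (gmk (beta G) (𝟙 _)) =
    tmk T p.el' (gmk (beta G) f.hom)
  rw [h1, ← act_gmk, ← tmk_bal, ← hom_id S, act_el']
  congr 1

end Prof2

theorem map_sumUlt_unit {X : Type u} (ν : Ultrafilter X) :
    ν.map (fun x => (⟨x, PUnit.unit⟩ : Σ _ : X, PUnit.{u + 1})) =
      sumUlt ν (fun _ => pure PUnit.unit) :=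
  ultrafilter_ext fun p hp => by
    rw [eventually_sumUlt]; exact hp

theorem map_sumUlt_assoc {X : Type u} {Y : X → Type u} {Z : (Σ x, Y x) → Type u}
    (ν : Ultrafilter X) (ξ : ∀ x, Ultrafilter (Y x)) (χ : ∀ y, Ultrafilter (Z y)) :
    (sumUlt (sumUlt ν ξ) χ).map (fun z => (⟨z.1.1, ⟨z.1.2, z.2⟩⟩ : Σ x, Σ y : Y x, Z ⟨x, y⟩)) =
      sumUlt ν (fun x => sumUlt (ξ x) (fun y => χ ⟨x, y⟩)) := rfl

theorem map_unit {X : Type u} (ν : Ultrafilter X) :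
    ν.map (fun x => (⟨PUnit.unit, x⟩ : Σ _ : PUnit.{u + 1}, X)) =
      sumUlt (pure PUnit.unit) (fun _ => ν) := rfl

section Prof3
variable [Category.{u} B] [Category.{u} C] [Category.{u} D] [Category.{u} E]

/-- An element of `P(d, c)` as an element of `(β P)(η d, η c)`. -/
def etaEl {P : Profunctor.{v} C D} {d : D} {c : C} (x : El P d c) :
    El (betaProf P) ((eta D).obj d) ((eta C).obj c) :=
  PreGerm.el' ⟨fun x => x, Ultrafilter.map_id _, fun _ => x⟩

theorem etaEl_act {P : Profunctor.{v} C D} {d d' : D} {c c' : C} (f : d' ⟶ d) (g : c ⟶ c')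
    (x : El P d c) :
    etaEl (act P f g x) = act (betaProf P) ((eta D).map f) ((eta C).map g) (etaEl x) :=
  (act_el' (P := P) (S := (eta D).obj d) (S' := (eta D).obj d') (T := (eta C).obj c)
    (T' := (eta C).obj c') ⟨fun x => x, Ultrafilter.map_id _, fun _ => f⟩
    ⟨fun x => x, Ultrafilter.map_id _, fun _ => g⟩
    ⟨fun x => x, Ultrafilter.map_id _, fun _ => x⟩).symm

/-- The naturality square `η_⋄ ∘ P ⇒ β P ∘ η_⋄` of the unit. -/
def etaSq (P : Profunctor.{v} C D) : Cell (graph (eta D) ⊙ P) (betaProf P ⊙ graph (eta C)) :=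
  Cell.ofComp (fun _ c _ f x => tmk ((eta C).obj c)
      (act (betaProf P) (garr f) (𝟙 ((eta C).obj c)) (etaEl x)) (gmk (eta C) (𝟙 _)))
    (fun {S c d d'} g f x => by
      rw [etaEl_act, garr_act, act_act]; simp)
    (fun {S S' c c' d} f g h x => by
      rw [etaEl_act, garr_act, act_act, act_tmk, act_act, act_gmk]
      have h1 : 𝟙 ((eta C).obj c) ≫ 𝟙 ((eta C).obj c) ≫ (eta C).map g =
        (eta C).map g ≫ 𝟙 ((eta C).obj c') ≫ (eta C).map (𝟙 c') := by simp
      rw [h1, ← act_gmk, ← tmk_bal, act_act]; simp)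

/-- An element of `(β β P)(S, T)` as an element of `(β P)(μ S, μ T)`. -/
noncomputable def muEl {P : Profunctor.{v} C D} {S : Ultrafamily.{u} (Ultrafamily.{u} D)}
    {T : Ultrafamily.{u} (Ultrafamily.{u} C)} (x : El (betaProf (betaProf P)) S T) :
    El (betaProf P) ((mu D).obj S) ((mu C).obj T) :=
  bmk (Germ.flatten (H := El P) (bgerm x))

/-- The representative of an element of `β β P` given by simultaneous representatives. -/
def rep₂ {P : Profunctor.{v} C D} {S : Ultrafamily.{u} (Ultrafamily.{u} D)}
    {T : Ultrafamily.{u} (Ultrafamily.{u} C)} (g : T.idx → S.idx) (hg : T.ult.map g = S.ult)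
    (q : ∀ y, PreGerm (El P) (S.fam (g y)) (T.fam y)) : PreGerm (El (betaProf P)) S T :=
  ⟨g, hg, fun y => (q y).el'⟩

@[elab_as_elim]
theorem el_ind₂ {P : Profunctor.{v} C D} {S : Ultrafamily.{u} (Ultrafamily.{u} D)}
    {T : Ultrafamily.{u} (Ultrafamily.{u} C)} {motive : El (betaProf (betaProf P)) S T → Prop}
    (h : ∀ g hg q, motive (PreGerm.el' (rep₂ g hg q))) (x : El (betaProf (betaProf P)) S T) :
    motive x :=
  Germ.ind₂ (H := El P) (motive := motive) h x

/-- The sum of a family of representatives of elements of `β P`. -/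
noncomputable def sumEl {P : Profunctor.{v} C D} {S : Ultrafamily.{u} (Ultrafamily.{u} D)}
    {T : Ultrafamily.{u} (Ultrafamily.{u} C)} (g : T.idx → S.idx) (hg : T.ult.map g = S.ult)
    (q : ∀ y, PreGerm (El P) (S.fam (g y)) (T.fam y)) :
    PreGerm (El P) ((mu D).obj S) ((mu C).obj T) := PreGerm.sum g hg q

theorem muEl_el' {P : Profunctor.{v} C D} {S : Ultrafamily.{u} (Ultrafamily.{u} D)}
    {T : Ultrafamily.{u} (Ultrafamily.{u} C)} (g : T.idx → S.idx) (hg : T.ult.map g = S.ult)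
    (q : ∀ y, PreGerm (El P) (S.fam (g y)) (T.fam y)) :
    muEl (rep₂ g hg q).el' = (sumEl g hg q).el' :=
  Germ.flatten_germ (H := El P) ⟨g, hg, fun y => (q y).germ⟩ q (fun _ => rfl)

/-- The representative of an arrow of `β β C` given by simultaneous representatives. -/
def homRep₂ {S T : Ultrafamily.{u} (Ultrafamily.{u} C)} (g : T.idx → S.idx)
    (hg : T.ult.map g = S.ult) (q : ∀ y, PreHom (S.fam (g y)) (T.fam y)) : PreHom S T :=
  ⟨g, hg, fun y => (q y).hom⟩

@[elab_as_elim]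
theorem hom_ind₂ {S T : Ultrafamily.{u} (Ultrafamily.{u} C)} {motive : (S ⟶ T) → Prop}
    (h : ∀ g hg q, motive (PreGerm.hom (homRep₂ g hg q))) (x : S ⟶ T) : motive x :=
  Germ.ind₂ (H := homs C) (motive := motive) h x

/-- The sum of a family of representatives of arrows. -/
noncomputable def sumHom {S T : Ultrafamily.{u} (Ultrafamily.{u} C)} (g : T.idx → S.idx)
    (hg : T.ult.map g = S.ult) (q : ∀ y, PreHom (S.fam (g y)) (T.fam y)) :
    PreHom ((mu C).obj S) ((mu C).obj T) := PreGerm.sum g hg q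

theorem mu_map_hom {S T : Ultrafamily.{u} (Ultrafamily.{u} C)} (g : T.idx → S.idx)
    (hg : T.ult.map g = S.ult) (q : ∀ y, PreHom (S.fam (g y)) (T.fam y)) :
    (mu C).map (homRep₂ g hg q).hom = (sumHom g hg q).hom :=
  Germ.flatten_germ (H := homs C) ⟨g, hg, fun y => (q y).germ⟩ q (fun _ => rfl)

theorem muEl_act {P : Profunctor.{v} C D} {S S' : Ultrafamily.{u} (Ultrafamily.{u} D)}
    {T T' : Ultrafamily.{u} (Ultrafamily.{u} C)} (f : S' ⟶ S) (g : T ⟶ T')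
    (x : El (betaProf (betaProf P)) S T) :
    muEl (act (betaProf (betaProf P)) f g x) =
      act (betaProf P) ((mu D).map f) ((mu C).map g) (muEl x) := by
  refine hom_ind₂ (fun f hf p => ?_) f
  refine hom_ind₂ (fun g hg q => ?_) g
  refine el_ind₂ (fun h hh r => ?_) x
  rw [act_el', mu_map_hom, mu_map_hom, muEl_el', act_el']
  have hh' : T'.ult.map (fun y => f (h (g y))) = S'.ult :=
    (PreGerm.actEl (homRep₂ f hf p) (homRep₂ g hg q) (rep₂ h hh r)).map_fn
  have : PreGerm.actEl (homRep₂ f hf p) (homRep₂ g hg q) (rep₂ h hh r) =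
      rep₂ (fun y => f (h (g y))) hh' (fun y => PreGerm.actEl (p (h (g y))) (q y) (r (g y))) := by
    simp only [PreGerm.actEl, homRep₂, rep₂, act_el']
  rw [this, muEl_el']
  rfl

/-- The naturality square `μ_⋄ ∘ β β P ⇒ β P ∘ μ_⋄` of the multiplication. -/
noncomputable def muSq (P : Profunctor.{v} C D) :
    Cell (graph (mu D) ⊙ betaProf (betaProf P)) (betaProf P ⊙ graph (mu C)) :=
  Cell.ofComp (fun _ T _ f x => tmk ((mu C).obj T)
      (act (betaProf P) (garr f) (𝟙 ((mu C).obj T)) (muEl x)) (gmk (mu C) (𝟙 _)))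
    (fun {S c d d'} g f x => by
      rw [muEl_act, garr_act, act_act]; simp)
    (fun {S S' c c' d} f g h x => by
      rw [muEl_act, garr_act, act_act, act_tmk, act_act, act_gmk]
      have h1 : 𝟙 ((mu C).obj c) ≫ 𝟙 ((mu C).obj c) ≫ (mu C).map g =
        (mu C).map g ≫ 𝟙 ((mu C).obj c') ≫ (mu C).map (𝟙 c') := by simp
      rw [h1, ← act_gmk, ← tmk_bal, act_act]; simp)

/-- Naturality of the unit at a functor. -/
def etaNat (F : C ⥤ D) : eta C ⋙ beta F ⟶ F ⋙ eta D where
  app c := 𝟙 (unit (F.obj c))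
  naturality c c' f := by
    refine (Category.comp_id _).trans (Eq.trans ?_ (Category.id_comp _).symm)
    rfl

/-- Naturality of the multiplication at a functor. -/
noncomputable def muNat (F : C ⥤ D) : mu C ⋙ beta F ⟶ beta (beta F) ⋙ mu D where
  app T := 𝟙 ((beta F).obj ((mu C).obj T))
  naturality T T' f := by
    refine (Category.comp_id _).trans (Eq.trans ?_ (Category.id_comp _).symm)
    refine hom_ind₂ (fun f hf p => ?_) f
    have h1 : (beta (beta F)).map (PreGerm.hom (homRep₂ f hf p)) =
      PreGerm.hom (homRep₂ (S := (beta (beta F)).obj T) (T := (beta (beta F)).obj T') f hf fun y => (p y).bmap F) := rfl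
    rw [Functor.comp_map, Functor.comp_map, h1, mu_map_hom, beta_map_hom]
    exact (mu_map_hom (S := (beta (beta F)).obj T) (T := (beta (beta F)).obj T') f hf
      (fun y => (p y).bmap F)).symm

/-- The inverse `β (f_⋄) ∘ η_⋄ ⇒ η_⋄ ∘ f_⋄` of the naturality square at the graph of a functor. -/
def etaSqInv (F : C ⥤ D) : Cell (betaProf (graph F) ⊙ graph (eta C)) (graph (eta D) ⊙ graph F) :=
  whR (betaGraph F) (graph (eta C)) ⋆ graphComp (eta C) (beta F) ⋆ graphMap (etaNat F) ⋆
    graphCompInv F (eta D)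

/-- The inverse `β (f_⋄) ∘ μ_⋄ ⇒ μ_⋄ ∘ β β (f_⋄)` of the naturality square at the graph of a
functor. -/
noncomputable def muSqInv (F : C ⥤ D) :
    Cell (betaProf (graph F) ⊙ graph (mu C)) (graph (mu D) ⊙ betaProf (betaProf (graph F))) :=
  whR (betaGraph F) (graph (mu C)) ⋆ graphComp (mu C) (beta F) ⋆ graphMap (muNat F) ⋆
    graphCompInv (beta (beta F)) (mu D) ⋆
    whL (graph (mu D)) (betaGraphInv (beta F) ⋆ betaCell (betaGraphInv F))

/-- The inverse comparison `β (P ∘ β (f_⋄)) ⇒ β P ∘ β β (f_⋄)`. -/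
def betaCompInv (P : Profunctor.{v} (Ultrafamily.{u} D) E) (F : C ⥤ D) :
    Cell (betaProf (P ⊙ betaProf (graph F))) (betaProf P ⊙ betaProf (betaProf (graph F))) :=
  betaCell (whL P (betaGraph F)) ⋆ compRep P (beta F) ⋆
    whL (betaProf P) (betaGraphInv (beta F) ⋆ betaCell (betaGraphInv F))

/-- The identity transformation from the identity functor to `β` of the identity functor. -/
def betaId (C : Type (u + 1)) [Category.{u} C] : 𝟭 (Ultrafamily.{u} C) ⟶ beta (𝟭 C) where
  app S := 𝟙 S
  naturality S T f := by
    refine (Category.comp_id _).trans (Eq.trans ?_ (Category.id_comp _).symm)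
    refine hom_ind (fun f => ?_) f
    rfl

/-- The identification `1 ⇒ β 1`. -/
def betaOneInv (C : Type (u + 1)) [Category.{u} C] :
    Cell (one (Ultrafamily.{u} C)) (betaProf (one C)) :=
  graphMap (betaId C) ⋆ betaGraphInv (𝟭 C)

/-- The unit law `μ ∘ η β ⇒ 1`. -/
noncomputable def unitLeft (C : Type (u + 1)) [Category.{u} C] :
    eta (Ultrafamily.{u} C) ⋙ mu C ⟶ 𝟭 (Ultrafamily.{u} C) where
  app S := PreGerm.hom (S := (unit S).flatten) (T := S) ⟨fun x => ⟨PUnit.unit, x⟩, rfl, fun x => 𝟙 (S.fam x)⟩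
  naturality S T f := by
    refine hom_ind (fun f => ?_) f
    have h1 : (mu C).map ((eta (Ultrafamily.{u} C)).map f.hom) =
      PreGerm.hom (S := (unit S).flatten) (T := (unit T).flatten) (PreGerm.sum (S := unit S)
        (T := unit T) (fun x => x) (Ultrafilter.map_id _) (fun _ => f)) :=
      mu_map_hom (S := unit S) (T := unit T) _ _ _
    refine (congrArg (fun h => h ≫ _) h1).trans ?_
    refine (germ_congr (H := homs C) (S := (unit S).flatten) (T := T) (fun y => ?_))
    exact (Category.comp_id (f.el y)).trans (Category.id_comp (f.el y)).symm

/-- The unit law `μ ∘ β η ⇒ 1`. -/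
noncomputable def unitRight (C : Type (u + 1)) [Category.{u} C] :
    beta (eta C) ⋙ mu C ⟶ 𝟭 (Ultrafamily.{u} C) where
  app S := PreGerm.hom (S := flatten (S.map unit)) (T := S)
    ⟨fun x => ⟨x, PUnit.unit⟩, map_sumUlt_unit S.ult, fun x => 𝟙 (S.fam x)⟩
  naturality S T f := by
    refine hom_ind (fun f => ?_) f
    have h1 : (mu C).map ((beta (eta C)).map f.hom) =
      PreGerm.hom (S := flatten (S.map unit)) (T := flatten (T.map unit)) (PreGerm.sum
        (S := S.map unit) (T := T.map unit) f.fn f.map_fn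
        (fun y => ⟨fun x => x, Ultrafilter.map_id _, fun _ => f.el y⟩)) :=
      mu_map_hom (S := S.map unit) (T := T.map unit) _ _ _
    refine (congrArg (fun h => h ≫ _) h1).trans ?_
    refine (germ_congr (H := homs C) (S := flatten (S.map unit)) (T := T) (fun y => ?_))
    exact (Category.comp_id (f.el y)).trans (Category.id_comp (f.el y)).symm

/-- The associativity law `μ ∘ β μ ⇒ μ ∘ μ β`. -/
noncomputable def muAssoc (C : Type (u + 1)) [Category.{u} C] :
    beta (mu C) ⋙ mu C ⟶ mu (Ultrafamily.{u} C) ⋙ mu C where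
  app T := PreGerm.hom (S := flatten (T.map flatten)) (T := T.flatten.flatten)
    ⟨fun z => ⟨z.1.1, ⟨z.1.2, z.2⟩⟩, rfl, fun z => 𝟙 _⟩
  naturality T T' f := by
    refine hom_ind (fun f => ?_) f
    obtain ⟨g, hg, e⟩ := f
    have key : ∀ y, ∃ k hk q, e y = (homRep₂ (S := T.fam (g y)) (T := T'.fam y) k hk q).hom := by
      intro y
      refine hom_ind₂ (fun k hk q => ?_) (e y)
      exact ⟨k, hk, q, rfl⟩
    choose k hk q hq using key
    cases funext hq
    have e1 : (mu C).map ((beta (mu C)).map (PreGerm.hom (⟨g, hg, fun y => (homRep₂ (k y) (hk y) (q y)).hom⟩ : PreHom T T'))) =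
        PreGerm.hom (S := flatten (T.map flatten)) (T := flatten (T'.map flatten))
          (PreGerm.sum (S := T.map flatten) (T := T'.map flatten) g hg
            (fun y => PreGerm.sum (k y) (hk y) (q y))) := by
      refine Eq.trans (congrArg (mu C).map (?_ : _ = PreGerm.hom (homRep₂ (S := T.map flatten) (T := T'.map flatten) g hg
            (fun y => PreGerm.sum (k y) (hk y) (q y))))) (mu_map_hom (S := T.map flatten) (T := T'.map flatten) g hg _)
      exact germ_congr (fun y => mu_map_hom (k y) (hk y) (q y))
    have e2 : (mu C).map ((mu (Ultrafamily.{u} C)).map (PreGerm.hom (⟨g, hg, fun y => (homRep₂ (k y) (hk y) (q y)).hom⟩ : PreHom T T'))) =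
        PreGerm.hom (S := T.flatten.flatten) (T := T'.flatten.flatten)
          (PreGerm.sum (S := T.flatten) (T := T'.flatten) (fun z => ⟨g z.1, k z.1 z.2⟩) 
            (PreGerm.sum (H := homs (Ultrafamily.{u} C)) g hg (fun y => homRep₂ (k y) (hk y) (q y))).map_fn
            (fun y => q y.1 y.2)) := by
      refine Eq.trans (congrArg (mu C).map (mu_map_hom g hg (fun y => homRep₂ (k y) (hk y) (q y)))) ?_
      exact mu_map_hom (S := T.flatten) (T := T'.flatten) _ _ _
    refine (congrArg (fun h => h ≫ _) e1).trans (Eq.trans ?_ (congrArg (fun h => _ ≫ h) e2).symm)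
    refine germ_congr (H := homs C) (S := flatten (T.map flatten)) (T := T'.flatten.flatten) (fun y => ?_)
    exact (Category.comp_id _).trans (Category.id_comp _).symm

end Prof3

section Prof4
variable [Category.{u} B] [Category.{u} C] [Category.{u} D] [Category.{u} E]

theorem graph_bal (F : C ⥤ D) (P : Profunctor.{v} D E) {e : E} {d : D} {c : C} (q : El P e d)
    (x : d ⟶ F.obj c) :
    tmk d q (gmk F x) = tmk (F.obj c) (act P (𝟙 e) x q) (gmk F (𝟙 (F.obj c))) := by
  have h1 : gmk F x = act (graph F) x (𝟙 c) (gmk F (𝟙 (F.obj c))) := by rw [act_gmk]; simp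
  rw [tmk_bal, h1]

theorem etaSqInv_etaSq (F : C ⥤ D) : etaSqInv F ⋆ etaSq (graph F) = Cell.id _ := by
  ext S c x
  have h1 : ∀ (T : Ultrafamily.{u} C) (p : PreGerm (El (graph F)) S T) (g : PreHom T ((eta C).obj c)),
      (etaSqInv F ⋆ etaSq (graph F)).app S c (tmk T p.el' (gmk (eta C) g.hom)) =
        tmk T p.el' (gmk (eta C) g.hom) := by
    intro T p g
    refine Eq.trans ?_ (graph_bal (eta C) (betaProf (graph F)) p.el' g.hom).symm
    refine congrArg (fun t => tmk ((eta C).obj c) t (gmk (eta C) (𝟙 _))) ?_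
    have e1 : etaEl (gmk F (𝟙 (F.obj c))) = PreGerm.el' (P := graph F) (S := (eta D).obj (F.obj c)) (T := (eta C).obj c) ⟨fun x => x, Ultrafilter.map_id _, fun _ => gmk F (𝟙 (F.obj c))⟩ := rfl
    rw [e1, ← hom_id S, act_el']
    refine (act_el' (P := graph F) (S := (eta D).obj (F.obj c)) (T := (eta C).obj c) (((p.ofGraph.comp (homsComp D) (g.bmap F)).comp (homsComp D) (PreHom.id ((eta D).obj (F.obj c))))) (PreHom.id _) ⟨fun x => x, Ultrafilter.map_id _, fun _ => gmk F (𝟙 (F.obj c))⟩).trans ?_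
    refine germ_congr (fun y => ?_)
    refine (act_gmk F _ _ _).trans (Eq.trans ?_ (act_gmk F (𝟙 _) (g.el y) (garr (p.el (g.fn y)))).symm)
    have e2 : ∀ {a b : D} (x : a ⟶ b) (y : b ⟶ F.obj c),
        ((x ≫ y) ≫ 𝟙 (F.obj c)) ≫ 𝟙 (F.obj c) ≫ F.map (𝟙 c) = 𝟙 a ≫ x ≫ y := by
      intro a b x y; simp
    exact congrArg (gmk F) (e2 _ _)
  refine tmk_ind (fun T p g => ?_) x
  rw [← gmk_garr g]
  generalize garr g = g
  refine el_ind (fun p => ?_) p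
  refine hom_ind (fun g => ?_) g
  exact h1 T p g
theorem etaSq_etaSqInv (F : C ⥤ D) : etaSq (graph F) ⋆ etaSqInv F = Cell.id _ := by
  ext S c x
  refine tmk_ind (fun d f y => ?_) x
  rw [← gmk_garr f, ← gmk_garr y]
  generalize garr f = f
  generalize garr y = y
  refine Eq.trans ?_ (graph_bal F (graph (eta D)) (gmk (eta D) f) y).symm
  refine hom_ind (fun f => ?_) f
  refine congrArg (fun t => tmk (F.obj c) t (gmk F (𝟙 (F.obj c)))) ?_
  rw [act_gmk]
  have e1 : etaEl (gmk F y) = PreGerm.el' (P := graph F) (S := (eta D).obj d) (T := (eta C).obj c)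
    ⟨fun x => x, Ultrafilter.map_id _, fun _ => gmk F y⟩ := rfl
  have e2 : act (betaProf (graph F)) f.hom (𝟙 ((eta C).obj c)) (etaEl (gmk F y)) =
      PreGerm.el' (P := graph F) ⟨f.fn, f.map_fn, fun z => gmk F (f.el z ≫ y)⟩ := by
    rw [e1, ← hom_id ((eta C).obj c), act_el']
    refine germ_congr (fun z => ?_)
    have e2 : ∀ {a : D} (x : a ⟶ d), x ≫ y ≫ F.map (𝟙 c) = x ≫ y := by
      intro a x; simp
    exact (act_gmk F _ _ _).trans (congrArg (gmk F) (e2 _))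
  refine (congrArg (fun t => gmk (eta D) (((garr ((betaGraph F).app _ _ t)) ≫ (beta F).map (𝟙 ((eta C).obj c))) ≫ 𝟙 ((eta D).obj (F.obj c)))) e2).trans ?_
  refine congrArg (gmk (eta D)) ?_
  rw [(beta F).map_id]
  refine (Category.comp_id _).trans ((Category.comp_id _).trans ?_)
  rw [Category.id_comp]
  rfl

theorem muSq_muSqInv (F : C ⥤ D) : muSq (graph F) ⋆ muSqInv F = Cell.id _ := by
  ext S U x
  refine tmk_ind (fun T f y => ?_) x
  refine el_ind₂ (fun k hk q => ?_) y
  rw [← gmk_garr f]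
  generalize garr f = f
  let I := betaGraphInv (beta F) ⋆ betaCell (betaGraphInv F)
  let V := (beta (beta F)).obj U
  let e : PreHom T V := ⟨k, hk, fun y => (q y).ofGraph.hom⟩
  have e0 : PreGerm.el' (rep₂ k hk q) = act (betaProf (betaProf (graph F))) e.hom (𝟙 U) (I.app V U (gmk (beta (beta F)) (𝟙 V))) := by
    rw [← I.naturality, act_gmk]
    have : e.hom ≫ 𝟙 V ≫ (beta (beta F)).map (𝟙 U) = e.hom := by
      rw [(beta (beta F)).map_id]
      exact (congrArg (fun t => e.hom ≫ t) (Category.comp_id (𝟙 V))).trans (Category.comp_id _)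
    rw [this]; rfl
  refine Eq.trans ?_ (congrArg (tmk T (gmk (mu D) f)) e0).symm
  rw [← tmk_bal, act_gmk]
  refine congrArg (fun t => tmk V t (I.app V U (gmk (beta (beta F)) (𝟙 V)))) (?_ : gmk (mu D) _ = _)
  refine congrArg (gmk (mu D)) ?_
  refine hom_ind (fun f => ?_) f
  have e2 : act (betaProf (graph F)) f.hom (𝟙 ((mu C).obj U)) (muEl (PreGerm.el' (rep₂ k hk q))) =
      PreGerm.el' (P := graph F) (PreGerm.actEl f (PreHom.id _) (sumEl k hk q)) := by
    rw [muEl_el', ← hom_id ((mu C).obj U), act_el']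
  refine (congrArg (fun t => (((garr ((betaGraph F).app _ _ t)) ≫ (beta F).map (𝟙 ((mu C).obj U))) ≫ 𝟙 ((mu D).obj V))) e2).trans ?_
  rw [(beta F).map_id]
  refine (Category.comp_id _).trans ((Category.comp_id _).trans ?_)
  rw [Category.id_comp]
  refine Eq.trans ?_ (congrArg (fun t => f.hom ≫ t) (mu_map_hom (S := T) (T := V) k hk (fun y => (q y).ofGraph))).symm
  refine germ_congr (fun y => ?_)
  have e2 : ∀ {a b : D} (x : a ⟶ b) {c : C} (y : El (graph F) b c), garr (act (graph F) x (𝟙 c) y) = x ≫ garr y := by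
      intro a b x c y; rw [garr_act]; simp
  exact e2 _ _

theorem muSqInv_muSq (F : C ⥤ D) : muSqInv F ⋆ muSq (graph F) = Cell.id _ := by
  ext S U x
  refine tmk_ind (fun T p g => ?_) x
  rw [← gmk_garr g]
  generalize garr g = g
  refine el_ind (fun p => ?_) p
  refine hom_ind (fun g => ?_) g
  refine Eq.trans ?_ (graph_bal (mu C) (betaProf (graph F)) p.el' g.hom).symm
  refine congrArg (fun t => tmk ((mu C).obj U) t (gmk (mu C) (𝟙 _))) ?_
  let q : ∀ y, PreGerm (El (graph F)) ((beta F).obj (U.fam y)) (U.fam y) := fun y => (PreHom.id ((beta F).obj (U.fam y))).toGraph F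
  have e1 : muEl ((betaGraphInv (beta F) ⋆ betaCell (betaGraphInv F)).app ((beta (beta F)).obj U) U
    (gmk (beta (beta F)) (𝟙 _))) = PreGerm.el' (sumEl (S := (beta (beta F)).obj U) (T := U) (fun y => y) (Ultrafilter.map_id _) q) :=
    muEl_el' (S := (beta (beta F)).obj U) (T := U) (fun y => y) (Ultrafilter.map_id _) q
  let h : PreHom S ((beta F).obj ((mu C).obj U)) := (p.ofGraph.comp (homsComp D) (g.bmap F)).comp (homsComp D) (PreHom.id _)
  refine (congrArg (fun t => act (betaProf (graph F)) (d := (mu D).obj ((beta (beta F)).obj U)) h.hom (𝟙 ((mu C).obj U)) t) e1).trans ?_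
  rw [← hom_id ((mu C).obj U), ← hom_id S, act_el']
  refine (act_el' h (PreHom.id _) (sumEl (S := (beta (beta F)).obj U) (T := U) (fun y => y)
    (Ultrafilter.map_id _) q)).trans ?_
  refine germ_congr (fun y => ?_)
  refine (act_gmk F _ _ _).trans (Eq.trans ?_ (act_gmk F (𝟙 _) (g.el y) (garr (p.el (g.fn y)))).symm)
  have e2 : ∀ {a b : D} {c : C} (x : a ⟶ b) (y : b ⟶ F.obj c),
      ((x ≫ y) ≫ 𝟙 (F.obj c)) ≫ 𝟙 (F.obj c) ≫ F.map (𝟙 c) = 𝟙 a ≫ x ≫ y := by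
    intro a b c x y; simp
  exact congrArg (gmk F) (e2 _ _)
theorem betaGraph_inv_evalGraph (P : Profunctor.{v} (Ultrafamily.{u} D) E) (F : C ⥤ D) {e : E}
    {T : Ultrafamily.{u} C} (x : El (P ⊙ betaProf (graph F)) e T) :
    tmk ((beta F).obj T) (evalGraph ((whL P (betaGraph F)).app e T x))
      ((betaGraphInv F).app _ T (gmk (beta F) (𝟙 _))) = x := by
  refine tmk_ind (fun d p q => ?_) x
  have h1 := congrArg ((whL P (betaGraphInv F)).app e T)
    (evalGraph_inv ((whL P (betaGraph F)).app e T (tmk d p q)))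
  refine Eq.trans h1 ?_
  exact congrArg (tmk d p) (congrArg (fun c => c.app d T q) (betaGraph_betaGraphInv F))

theorem betaCompInv_betaComp (P : Profunctor.{v} (Ultrafamily.{u} D) E) (F : C ⥤ D) :
    betaCompInv P F ⋆ betaComp P (betaProf (graph F)) = Cell.id _ := by
  ext S U x
  refine el_ind (fun p => ?_) x
  refine germ_congr (e' := p.el) (fun y => ?_)
  exact betaGraph_inv_evalGraph P F (p.el y)

theorem betaComp_betaCompInv (P : Profunctor.{v} (Ultrafamily.{u} D) E) (F : C ⥤ D) :
    betaComp P (betaProf (graph F)) ⋆ betaCompInv P F = Cell.id _ := by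
  ext S U x
  refine tmk_ind (fun T p q => ?_) x
  refine el_ind (fun p => ?_) p
  refine el_ind₂ (fun k hk q => ?_) q
  let I := betaGraphInv (beta F) ⋆ betaCell (betaGraphInv F)
  let V := (beta (beta F)).obj U
  let e : PreHom T V := ⟨k, hk, fun y => (q y).ofGraph.hom⟩
  have e0 : PreGerm.el' (rep₂ k hk q) =
      act (betaProf (betaProf (graph F))) e.hom (𝟙 U) (I.app V U (gmk (beta (beta F)) (𝟙 V))) := by
    rw [← I.naturality, act_gmk]
    have : e.hom ≫ 𝟙 V ≫ (beta (beta F)).map (𝟙 U) = e.hom := by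
      rw [(beta (beta F)).map_id]
      exact (congrArg (fun t => e.hom ≫ t) (Category.comp_id (𝟙 V))).trans (Category.comp_id _)
    rw [this]; rfl
  refine Eq.trans ?_ (congrArg (tmk T p.el') e0).symm
  rw [← tmk_bal]
  refine congrArg (fun t => tmk V t (I.app V U (gmk (beta (beta F)) (𝟙 V)))) ?_
  rw [← hom_id S, act_el']
  exact germ_congr (fun y => rfl)

/-! ### Comparison with the description through categories of elements -/

/-- The category of elements of a profunctor `P : C ⇸ D`. -/
structure Elts (P : Profunctor.{u} C D) : Type (u + 1) where
  dst : D
  src : C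
  el : El P dst src

/-- Arrows of the category of elements. -/
@[ext]
structure Elts.Hom {P : Profunctor.{u} C D} (x y : Elts P) : Type u where
  dst : x.dst ⟶ y.dst
  src : x.src ⟶ y.src
  w : act P (𝟙 x.dst) src x.el = act P dst (𝟙 y.src) y.el

instance (P : Profunctor.{u} C D) : Category.{u} (Elts P) where
  Hom := Elts.Hom
  id x := ⟨𝟙 _, 𝟙 _, rfl⟩
  comp {x y z} f g := ⟨f.dst ≫ g.dst, f.src ≫ g.src, by
    have h1 := congrArg (act P (𝟙 x.dst) g.src) f.w
    have h2 := congrArg (act P f.dst (𝟙 z.src)) g.w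
    rw [act_act, act_act] at h1 h2
    simp only [Category.id_comp, Category.comp_id] at h1 h2
    rw [h1, h2]⟩

/-- The projection of the category of elements to `D`. -/
def Elts.fst (P : Profunctor.{u} C D) : Elts P ⥤ D where
  obj x := x.dst
  map f := Elts.Hom.dst f

/-- The projection of the category of elements to `C`. -/
def Elts.snd (P : Profunctor.{u} C D) : Elts P ⥤ C where
  obj x := x.src
  map f := Elts.Hom.src f

/-- The cograph `f^⋄ : D ⇸ C` of a functor `f : C ⥤ D`, given by `f^⋄ (c, d) = D(f c, d)`. -/
def cograph (F : C ⥤ D) : Profunctor.{u} D C :=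
  mkProf (fun c d => F.obj c ⟶ d) (fun f g x => F.map f ≫ x ≫ g) (fun c d x => by simp)
    (fun f g f' g' x => by simp)

/-- An arrow as an element of `f^⋄`. -/
def cmk (F : C ⥤ D) {c : C} {d : D} (x : F.obj c ⟶ d) : El (cograph F) c d := x

/-- An element of `f^⋄` as an arrow. -/
def carr {F : C ⥤ D} {c : C} {d : D} (x : El (cograph F) c d) : F.obj c ⟶ d := x

theorem act_cmk (F : C ⥤ D) {c c' : C} {d d' : D} (f : c' ⟶ c) (g : d ⟶ d') (x : F.obj c ⟶ d) :
    act (cograph F) f g (cmk F x) = cmk F (F.map f ≫ x ≫ g) := act_mkProf _ _ _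

/-- The tautological element of `β P` at an ultrafamily in the category of elements. -/
def tautEl {P : Profunctor.{u} C D} (Z : Ultrafamily.{u} (Elts P)) :
    PreGerm (El P) ((beta (Elts.fst P)).obj Z) ((beta (Elts.snd P)).obj Z) :=
  ⟨fun z => z, Ultrafilter.map_id _, fun z => (Z.fam z).el⟩

theorem tautEl_act {P : Profunctor.{u} C D} {Z Z' : Ultrafamily.{u} (Elts P)} (k : Z ⟶ Z') :
    act (betaProf P) ((beta (Elts.fst P)).map k) (𝟙 _) (tautEl Z').el' =
      act (betaProf P) (𝟙 _) ((beta (Elts.snd P)).map k) (tautEl Z).el' := by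
  refine hom_ind (fun k => ?_) k
  rw [beta_map_hom, beta_map_hom, ← hom_id, ← hom_id, act_el', act_el']
  exact germ_congr (fun y => (Elts.Hom.w (k.el y)).symm)

/-- The comparison `(β π₁)_⋄ ∘ (β π₂)^⋄ ⇒ β P`, for the projections `π₁`, `π₂` of the category of
elements of `P`. -/
def eltsCell (P : Profunctor.{u} C D) :
    Cell (graph (beta (Elts.fst P)) ⊙ cograph (beta (Elts.snd P))) (betaProf P) :=
  Cell.ofComp (fun _ _ Z f g => act (betaProf P) (garr f) (carr g) (tautEl Z).el')
    (fun {S T Z Z'} k f g => by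
      rw [garr_act, ← gmk_garr f]
      have h2 : carr (act (cograph (beta (Elts.snd P))) k (𝟙 T) g) = (beta (Elts.snd P)).map k ≫ carr g := by
        refine (congrArg carr (act_cmk (beta (Elts.snd P)) k (𝟙 T) (carr g))).trans ?_
        exact congrArg (fun t => _ ≫ t) (Category.comp_id _)
      rw [h2]
      have h3 := congrArg (act (betaProf P) (garr f) (carr g)) (tautEl_act k)
      rw [act_act, act_act] at h3
      simpa using h3)
    (fun {S S' T T' Z} k l f g => by
      have h2 : carr (act (cograph (beta (Elts.snd P))) (𝟙 Z) l g) = carr g ≫ l := by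
        refine (congrArg carr (act_cmk (beta (Elts.snd P)) (𝟙 Z) l (carr g))).trans ?_
        rw [CategoryTheory.Functor.map_id]; exact Category.id_comp _
      rw [garr_act, h2, act_act]; simp)

/-- The ultrafamily of elements underlying a representative. -/
def eltsFam {P : Profunctor.{u} C D} {S : Ultrafamily.{u} D} {T : Ultrafamily.{u} C}
    (p : PreGerm (El P) S T) : Ultrafamily.{u} (Elts P) :=
  ⟨T.idx, fun y => ⟨S.fam (p.fn y), T.fam y, p.el y⟩, T.ult⟩

/-- The preimage of a representative under the comparison. -/
def eltsRep {P : Profunctor.{u} C D} {S : Ultrafamily.{u} D} {T : Ultrafamily.{u} C}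
    (p : PreGerm (El P) S T) :
    El (graph (beta (Elts.fst P)) ⊙ cograph (beta (Elts.snd P))) S T :=
  tmk (eltsFam p) (gmk (beta (Elts.fst P)) (PreGerm.hom ⟨p.fn, p.map_fn, fun y => 𝟙 (S.fam (p.fn y))⟩))
    (cmk (beta (Elts.snd P)) (𝟙 T))

theorem eltsCell_eltsRep {P : Profunctor.{u} C D} {S : Ultrafamily.{u} D} {T : Ultrafamily.{u} C}
    (p : PreGerm (El P) S T) : (eltsCell P).app S T (eltsRep p) = p.el' := by
  refine (act_el' (T := T) _ (PreHom.id T) (tautEl (eltsFam p))).trans ?_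
  exact germ_congr (fun y => act_id P (p.el y))

theorem tmk_cmk_comp {P : Profunctor.{u} C D} {S : Ultrafamily.{u} D} {T : Ultrafamily.{u} C}
    {Z Z' : Ultrafamily.{u} (Elts P)} (k : Z ⟶ Z') (f : S ⟶ (beta (Elts.fst P)).obj Z)
    (g : (beta (Elts.snd P)).obj Z' ⟶ T) :
    tmk Z (gmk (beta (Elts.fst P)) f) (cmk (beta (Elts.snd P)) ((beta (Elts.snd P)).map k ≫ g)) =
      tmk Z' (gmk (beta (Elts.fst P)) (f ≫ (beta (Elts.fst P)).map k))
        (cmk (beta (Elts.snd P)) g) := by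
  have h1 : cmk (beta (Elts.snd P)) ((beta (Elts.snd P)).map k ≫ g) =
      act (cograph (beta (Elts.snd P))) k (𝟙 T) (cmk (beta (Elts.snd P)) g) := by
    rw [act_cmk, Category.comp_id]
  rw [h1, ← tmk_bal, act_gmk, Category.id_comp]

theorem act_split (P : Profunctor.{v} C D) {d d' : D} {c c' : C} (f : d' ⟶ d) (g : c ⟶ c')
    (x : El P d c) : act P (𝟙 d') (𝟙 c') (act P f g x) = act P f (𝟙 c') (act P (𝟙 d) g x) := by
  rw [act_act, act_act]; simp

theorem eltsRep_act {P : Profunctor.{u} C D} {S : Ultrafamily.{u} D} {T : Ultrafamily.{u} C}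
    {Z : Ultrafamily.{u} (Elts P)} (f : PreHom S ((beta (Elts.fst P)).obj Z))
    (g : PreHom ((beta (Elts.snd P)).obj Z) T) :
    tmk Z (gmk (beta (Elts.fst P)) f.hom) (cmk (beta (Elts.snd P)) g.hom) =
      eltsRep (PreGerm.actEl f g (tautEl Z)) := by
  let W : Ultrafamily.{u} (Elts P) :=
    ⟨T.idx, fun y => ⟨(Z.fam (g.fn y)).dst, T.fam y, act P (𝟙 _) (g.el y) (Z.fam (g.fn y)).el⟩, T.ult⟩
  let k : PreHom Z W := ⟨g.fn, g.map_fn, fun y =>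
    (⟨𝟙 (Z.fam (g.fn y)).dst, g.el y, (act_id P _).symm⟩ : Elts.Hom (Z.fam (g.fn y)) (W.fam y))⟩
  let n : PreHom (eltsFam (PreGerm.actEl f g (tautEl Z))) W :=
    ⟨fun y => y, Ultrafilter.map_id _, fun y => (⟨f.el (g.fn y), 𝟙 (T.fam y), act_split P (f.el (g.fn y)) (g.el y) (Z.fam (g.fn y)).el⟩ : Elts.Hom _ _)⟩
  have e1 : g.hom = (beta (Elts.snd P)).map k.hom ≫ 𝟙 T := (Category.comp_id (PreGerm.hom g)).symm
  have e2 : 𝟙 T = (beta (Elts.snd P)).map n.hom ≫ 𝟙 T := (Category.comp_id (𝟙 T)).symm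
  have h1 := (congrArg (fun t => tmk Z (gmk (beta (Elts.fst P)) f.hom) (cmk (beta (Elts.snd P)) t)) e1).trans
    (tmk_cmk_comp k.hom f.hom (𝟙 T))
  let p := PreGerm.actEl f g (tautEl Z)
  let fp : S ⟶ (beta (Elts.fst P)).obj (eltsFam p) :=
    PreGerm.hom ⟨p.fn, p.map_fn, fun y => 𝟙 (S.fam (p.fn y))⟩
  have h2 := (congrArg (fun t => tmk (eltsFam p) (gmk (beta (Elts.fst P)) fp) (cmk (beta (Elts.snd P)) t)) e2).trans
    (tmk_cmk_comp n.hom fp (𝟙 T))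
  refine h1.trans (Eq.trans ?_ h2.symm)
  refine congrArg (fun t => tmk W (gmk (beta (Elts.fst P)) t) (cmk (beta (Elts.snd P)) (𝟙 T))) ?_
  refine germ_congr (fun y => ?_)
  exact (Category.comp_id _).trans (Category.id_comp _).symm

theorem eltsRep_congr {P : Profunctor.{u} C D} {S : Ultrafamily.{u} D} {T : Ultrafamily.{u} C}
    (p q : PreGerm (El P) S T) (hpq : p.germ = q.germ) : eltsRep p = eltsRep q := by
  classical
  have hV := PreGerm.germ_eq.1 hpq
  let Φ : ∀ z : T.idx × ULift.{u} Bool, Σ x, El P (S.fam x) (T.fam z.1) :=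
    fun z => if z.2.down then q.val z.1 else p.val z.1
  let V : T.idx → Prop := fun y => p.val y = q.val y
  let g₁ : T.idx → T.idx × ULift.{u} Bool := fun y => (y, ⟨false⟩)
  let g₂ : T.idx → T.idx × ULift.{u} Bool := fun y => (y, ⟨!decide (V y)⟩)
  have h12 : ∀ᶠ y in (T.ult : Filter T.idx), g₁ y = g₂ y := by
    filter_upwards [hV] with y hy
    have : V y := hy
    simp [g₁, g₂, this]
  have hm : T.ult.map g₂ = T.ult.map g₁ := by
    refine Ultrafilter.coe_injective ?_
    exact Filter.map_congr (h12.mono fun y hy => hy.symm)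
  have hΦ₂ : ∀ y, Φ (g₂ y) = q.val y := by
    intro y
    have aux : ∀ b : Bool, b = !decide (V y) → Φ (y, ⟨b⟩) = q.val y := by
      intro b hb
      cases b
      · exact of_decide_eq_true (p := V y) (by simpa using hb)
      · rfl
    exact aux _ rfl
  have hΦ : (T.ult.map g₁).map (fun z => (Φ z).1) = S.ult := p.map_fn
  let W : Ultrafamily.{u} (Elts P) :=
    ⟨T.idx × ULift.{u} Bool, fun z => ⟨S.fam (Φ z).1, T.fam z.1, (Φ z).2⟩, T.ult.map g₁⟩
  let f : S ⟶ (beta (Elts.fst P)).obj W :=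
    PreGerm.hom ⟨fun z => (Φ z).1, hΦ, fun z => 𝟙 (S.fam (Φ z).1)⟩
  have hom₂ : ∀ (b : T.idx → ULift.{u} Bool) (hb : T.ult.map (fun y => (y, b y)) = T.ult.map g₁)
      (hb' : T.ult.map (fun y => (Φ (y, b y)).1) = S.ult),
      eltsRep (⟨fun y => (Φ (y, b y)).1, hb', fun y => (Φ (y, b y)).2⟩ : PreGerm (El P) S T) =
        tmk W (gmk (beta (Elts.fst P)) f) (cmk (beta (Elts.snd P)) 
          (PreGerm.hom ⟨fun y => (y, b y), hb, fun y => 𝟙 (T.fam y)⟩ :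
            (beta (Elts.snd P)).obj W ⟶ T)) := by
    intro b hb hb'
    let k : PreHom W (eltsFam (⟨fun y => (Φ (y, b y)).1, hb', fun y => (Φ (y, b y)).2⟩ : PreGerm (El P) S T)) :=
      ⟨fun y => (y, b y), hb, fun y => 𝟙 _⟩
    have e1 : (PreGerm.hom ⟨fun y => (y, b y), hb, fun y => 𝟙 (T.fam y)⟩ :
        (beta (Elts.snd P)).obj W ⟶ T) = (beta (Elts.snd P)).map k.hom ≫ 𝟙 T :=
      (Category.comp_id ((beta (Elts.snd P)).map k.hom)).symm
    refine Eq.trans ?_ ((congrArg (fun t => tmk W (gmk (beta (Elts.fst P)) f)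
      (cmk (beta (Elts.snd P)) t)) e1).trans (tmk_cmk_comp k.hom f (𝟙 T))).symm
    refine congrArg (fun t => tmk (eltsFam _) (gmk (beta (Elts.fst P)) t) (cmk (beta (Elts.snd P)) (𝟙 T))) ?_
    refine germ_congr (fun y => ?_)
    exact (Category.comp_id _).symm
  have key : ∀ (ψ : ∀ y, Σ x, El P (S.fam x) (T.fam y)) (r : PreGerm (El P) S T)
      (hψ : T.ult.map (fun y => (ψ y).1) = S.ult) (_ : ∀ y, ψ y = r.val y),
      eltsRep r = eltsRep (⟨fun y => (ψ y).1, hψ, fun y => (ψ y).2⟩ : PreGerm (El P) S T) := by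
    intro ψ r hψ h
    cases (funext h : ψ = fun y => r.val y)
    rfl
  have hq : T.ult.map (fun y => (Φ (g₂ y)).1) = S.ult := by
    simp only [hΦ₂]; exact q.map_fn
  rw [key (fun y => Φ (g₁ y)) p p.map_fn (fun y => rfl), key (fun y => Φ (g₂ y)) q hq hΦ₂]
  refine (hom₂ (fun _ => ⟨false⟩) rfl p.map_fn).trans
    (Eq.trans ?_ (hom₂ (fun y => ⟨!decide (V y)⟩) hm hq).symm)
  refine congrArg (fun t => tmk W (gmk (beta (Elts.fst P)) f) (cmk (beta (Elts.snd P)) t)) ?_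
  refine hom_eq.2 ?_
  filter_upwards [h12] with y hy
  have : (⟨false⟩ : ULift.{u} Bool) = ⟨!decide (V y)⟩ := congrArg Prod.snd hy
  change (⟨(y, ⟨false⟩), 𝟙 (T.fam y)⟩ : Σ x : T.idx × ULift.{u} Bool, (T.fam x.1 ⟶ T.fam y)) =
    ⟨(y, ⟨!decide (V y)⟩), 𝟙 (T.fam y)⟩
  rw [← this]

/-- The comparison `(β π₁)_⋄ ∘ (β π₂)^⋄ ⇒ β P` is invertible. -/
theorem eltsCell_bijective (P : Profunctor.{u} C D) (S : Ultrafamily.{u} D)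
    (T : Ultrafamily.{u} C) : Function.Bijective ((eltsCell P).app S T) := by
  have key : ∀ x : El (graph (beta (Elts.fst P)) ⊙ cograph (beta (Elts.snd P))) S T,
      ∃ p : PreGerm (El P) S T, x = eltsRep p := by
    intro x
    refine tmk_ind (fun Z f g => ?_) x
    have h : ∀ (f : S ⟶ (beta (Elts.fst P)).obj Z) (g : (beta (Elts.snd P)).obj Z ⟶ T),
        ∃ p : PreGerm (El P) S T, tmk Z (gmk (beta (Elts.fst P)) f)
          (cmk (beta (Elts.snd P)) g) = eltsRep p := by
      intro f g
      refine hom_ind (fun f => ?_) f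
      refine hom_ind (fun g => ?_) g
      exact ⟨_, eltsRep_act f g⟩
    exact h (garr f) (carr g)
  constructor
  · intro x y hxy
    obtain ⟨p, rfl⟩ := key x
    obtain ⟨q, rfl⟩ := key y
    rw [eltsCell_eltsRep, eltsCell_eltsRep] at hxy
    exact eltsRep_congr p q hxy
  · intro x
    refine el_ind (fun p => ?_) x
    exact ⟨eltsRep p, eltsCell_eltsRep p⟩

end Prof4

/-! ### Ultraconvergence spaces, lax algebras and their morphisms -/

section Spaces

variable {A₀ : Type (u + 1)} [Category.{u} A₀]

/-- The arrow `(X, h, ν) ⟶ (Y, h ∘ g, ξ)` of `β A₀` given by `g : Y → X` with `g_* ξ = ν`. -/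
def reindex (S : Ultrafamily.{u} A₀) {Y : Type u} (ξ : Ultrafilter Y) (g : Y → S.idx)
    (hg : ξ.map g = S.ult) : S ⟶ ⟨Y, fun y => S.fam (g y), ξ⟩ :=
  PreGerm.hom ⟨g, hg, fun y => 𝟙 (S.fam (g y))⟩

/-- The arrow `g ⊗ id : (c x z)_{(x, z)} ⟶ (c (g y) z)_{(y, z)}`. -/
def tensorLeft {X Y : Type u} {ν : Ultrafilter X} (K : X → Ultrafamily.{u} A₀)
    (ξ : Ultrafilter Y) (g : Y → X) (hg : ξ.map g = ν) :
    flatten ⟨X, K, ν⟩ ⟶ flatten ⟨Y, fun y => K (g y), ξ⟩ :=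
  PreGerm.hom
    ⟨fun z => ⟨g z.1, z.2⟩, map_sumUlt g hg (fun _ z => z) fun _ => Ultrafilter.map_id _,
      fun z => 𝟙 ((K (g z.1)).fam z.2)⟩

/-- The arrow `id ⊗ (g_x)_x : (c x y)_{(x, y)} ⟶ (d x z)_{(x, z)}`. -/
def tensorRight {X : Type u} (ν : Ultrafilter X) {K K' : X → Ultrafamily.{u} A₀}
    (g : ∀ x, PreHom (K x) (K' x)) : flatten ⟨X, K, ν⟩ ⟶ flatten ⟨X, K', ν⟩ :=
  PreGerm.hom
    ⟨fun z => ⟨z.1, (g z.1).fn z.2⟩,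
      map_sumUlt (fun x => x) (Ultrafilter.map_id _) (fun x => (g x).fn) fun x => (g x).map_fn,
      fun z => (g z.1).el z.2⟩

end Spaces

/-- An ultraconvergence space with underlying discrete category `A₀`.  The equations between
ultraconvergence arrows whose targets have different index sets are stated along the canonical
reindexing isomorphisms of `β A₀`: `x ↦ (*, x)` and `x ↦ (x, *)` for the unit laws,
`((x, y), z) ↦ (x, (y, z))` for associativity. -/
structure UltraconvergenceSpace (A₀ : Type (u + 1)) [Category.{u} A₀] [IsDiscrete A₀] where
  /-- The profunctor `A : β A₀ ⇸ A₀`; the elements of `A(a, S)` are the ultraconvergence arrows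
  from `a` to `S`, and `r[g] = A(id, g)(r)`. -/
  arr : Profunctor.{u} (Ultrafamily.{u} A₀) A₀
  small : IsSmallProf arr
  /-- Identities. -/
  ident : ∀ a : A₀, El arr a (unit a)
  /-- The composite `(s_x)_x · r` of an ultraconvergence arrow `r` from `a` to
  `S = (b_x)_{x : ν}` and of ultraconvergence arrows `s x` from `b_x` to `K x`. -/
  comp : ∀ {a : A₀} {S : Ultrafamily.{u} A₀} (_ : El arr a S) {K : S.idx → Ultrafamily.{u} A₀}
    (_ : ∀ x, El arr (S.fam x) (K x)), El arr a (flatten ⟨S.idx, K, S.ult⟩)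
  /-- Left naturality `(s_{g y})_y · r[g] = ((s_x)_x · r)[g ⊗ id]`.  (As `A₀` is discrete, a
  representative of an arrow out of `S` is a reindexing of `S`.) -/
  left_nat : ∀ {a : A₀} {S : Ultrafamily.{u} A₀} (r : El arr a S) {K : S.idx → Ultrafamily.{u} A₀}
    (s : ∀ x, El arr (S.fam x) (K x)) {Y : Type u} (ξ : Ultrafilter Y) (g : Y → S.idx)
    (hg : ξ.map g = S.ult),
    comp (S := ⟨Y, fun y => S.fam (g y), ξ⟩) (act arr (𝟙 a) (reindex S ξ g hg) r)
        (fun y => s (g y)) =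
      act arr (𝟙 a) (tensorLeft K ξ g hg) (comp r s)
  /-- Right naturality `(s_x[g_x])_x · r = ((s_x)_x · r)[id ⊗ (g_x)_x]`. -/
  right_nat : ∀ {a : A₀} {S : Ultrafamily.{u} A₀} (r : El arr a S)
    {K K' : S.idx → Ultrafamily.{u} A₀} (s : ∀ x, El arr (S.fam x) (K x))
    (g : ∀ x, PreHom (K x) (K' x)),
    comp r (fun x => act arr (𝟙 (S.fam x)) (g x).hom (s x)) =
      act arr (𝟙 a) (tensorRight S.ult g) (comp r s)
  /-- Left unitality `(r)_* · id_a = r`. -/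
  left_unit : ∀ {a : A₀} {S : Ultrafamily.{u} A₀} (r : El arr a S),
    act arr (𝟙 a) ((unitLeft A₀).app S) (comp (ident a) (K := fun _ => S) (fun _ => r)) = r
  /-- Right unitality `(id_{b_x})_x · r = r`. -/
  right_unit : ∀ {a : A₀} {S : Ultrafamily.{u} A₀} (r : El arr a S),
    act arr (𝟙 a) ((unitRight A₀).app S) (comp r (fun x => ident (S.fam x))) = r
  /-- Associativity `(t_{x,y})_{(x,y)} · ((s_x)_x · r) = ((t_{x,y})_y · s_x)_x · r`. -/
  assoc : ∀ {a : A₀} {S : Ultrafamily.{u} A₀} (r : El arr a S) {K : S.idx → Ultrafamily.{u} A₀}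
    (s : ∀ x, El arr (S.fam x) (K x)) {J : ∀ x, (K x).idx → Ultrafamily.{u} A₀}
    (t : ∀ x y, El arr ((K x).fam y) (J x y)),
    comp (comp r s) (fun z => t z.1 z.2) =
      act arr (𝟙 a)
        ((muAssoc A₀).app ⟨S.idx, fun x => ⟨(K x).idx, fun y => J x y, (K x).ult⟩, S.ult⟩)
        (comp r (fun x => comp (s x) (t x)))

/-- A lax algebra for the extension of the ultracompletion pseudomonad `β` to profunctors, with
underlying category `A₀`: a small profunctor `a : β A₀ ⇸ A₀` and 2-cells `Γ : 1 ⇒ a ∘ η_⋄`,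
`Δ : a ∘ β a ⇒ a ∘ μ_⋄` subject to the two unit laws and the associativity law, which are written
out below as equalities of composites of 2-cells (`⋆` is vertical composition in diagrammatic
order, `whL` and `whR` are whiskerings). -/
structure LaxAlgebra (A₀ : Type (u + 1)) [Category.{u} A₀] where
  arr : Profunctor.{u} (Ultrafamily.{u} A₀) A₀
  small : IsSmallProf arr
  /-- The 2-cell `Γ : 1 ⇒ a ∘ η_⋄`. -/
  unit : Cell (one A₀) (arr ⊙ graph (eta A₀))
  /-- The 2-cell `Δ : a ∘ β a ⇒ a ∘ μ_⋄`. -/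
  mult : Cell (arr ⊙ betaProf arr) (arr ⊙ graph (mu A₀))
  /-- `a ⇒ 1 ∘ a ⇒ a ∘ η ∘ a ⇒ a ∘ β a ∘ η β ⇒ a ∘ μ ∘ η β ⇒ a` is the identity. -/
  unit_left :
    lunitInv arr ⋆ whR unit arr ⋆ assocHom arr (graph (eta A₀)) arr ⋆ whL arr (etaSq arr) ⋆
      assocInv arr (betaProf arr) (graph (eta (Ultrafamily.{u} A₀))) ⋆
      whR mult (graph (eta (Ultrafamily.{u} A₀))) ⋆
      assocHom arr (graph (mu A₀)) (graph (eta (Ultrafamily.{u} A₀))) ⋆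
      whL arr (graphComp (eta (Ultrafamily.{u} A₀)) (mu A₀) ⋆ graphMap (unitLeft A₀)) ⋆
      runit arr = Cell.id arr
  /-- `a ⇒ a ∘ β 1 ⇒ a ∘ β (a ∘ η) ⇒ a ∘ β a ∘ β η ⇒ a ∘ μ ∘ β η ⇒ a` is the identity. -/
  unit_right :
    runitInv arr ⋆ whL arr (betaOneInv A₀ ⋆ betaCell unit ⋆ compRep arr (eta A₀)) ⋆
      assocInv arr (betaProf arr) (graph (beta (eta A₀))) ⋆
      whR mult (graph (beta (eta A₀))) ⋆
      assocHom arr (graph (mu A₀)) (graph (beta (eta A₀))) ⋆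
      whL arr (graphComp (beta (eta A₀)) (mu A₀) ⋆ graphMap (unitRight A₀)) ⋆
      runit arr = Cell.id arr
  /-- `a ∘ β a ∘ β β a ⇒ a ∘ β (a ∘ β a) ⇒ a ∘ β (a ∘ μ) ⇒ a ∘ β a ∘ β μ ⇒ a ∘ μ ∘ β μ ⇒ a ∘ μ ∘ μ β`
  equals `a ∘ β a ∘ β β a ⇒ a ∘ μ ∘ β β a ⇒ a ∘ β a ∘ μ β ⇒ a ∘ μ ∘ μ β`. -/
  assoc :
    assocHom arr (betaProf arr) (betaProf (betaProf arr)) ⋆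
      whL arr (betaComp arr (betaProf arr) ⋆ betaCell mult ⋆ compRep arr (mu A₀)) ⋆
      assocInv arr (betaProf arr) (graph (beta (mu A₀))) ⋆
      whR mult (graph (beta (mu A₀))) ⋆
      assocHom arr (graph (mu A₀)) (graph (beta (mu A₀))) ⋆
      whL arr (graphComp (beta (mu A₀)) (mu A₀) ⋆ graphMap (muAssoc A₀)) =
    whR mult (betaProf (betaProf arr)) ⋆
      assocHom arr (graph (mu A₀)) (betaProf (betaProf arr)) ⋆
      whL arr (muSq arr) ⋆
      assocInv arr (betaProf arr) (graph (mu (Ultrafamily.{u} A₀))) ⋆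
      whR mult (graph (mu (Ultrafamily.{u} A₀))) ⋆
      assocHom arr (graph (mu A₀)) (graph (mu (Ultrafamily.{u} A₀))) ⋆
      whL arr (graphComp (mu (Ultrafamily.{u} A₀)) (mu A₀))

/-- The structure of a colax morphism of lax algebras on the graph `f_⋄` of a functor `f`: a 2-cell
`Θ : f_⋄ ∘ a ⇒ a' ∘ β (f_⋄)` compatible with the units and with the multiplications. -/
@[ext]
structure ColaxStructure {A₀ A₀' : Type (u + 1)} [Category.{u} A₀] [Category.{u} A₀']
    (L : LaxAlgebra A₀) (L' : LaxAlgebra A₀') (f : A₀ ⥤ A₀') where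
  /-- The 2-cell `Θ : f_⋄ ∘ a ⇒ a' ∘ β f_⋄`. -/
  cell : Cell (graph f ⊙ L.arr) (L'.arr ⊙ betaProf (graph f))
  /-- `f ⇒ f ∘ a ∘ η ⇒ a' ∘ β f ∘ η ⇒ a' ∘ η ∘ f` equals `f ⇒ a' ∘ η ∘ f`. -/
  unit_comp :
    runitInv (graph f) ⋆ whL (graph f) L.unit ⋆
      assocInv (graph f) L.arr (graph (eta A₀)) ⋆
      whR cell (graph (eta A₀)) ⋆
      assocHom L'.arr (betaProf (graph f)) (graph (eta A₀)) ⋆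
      whL L'.arr (etaSqInv f) =
    lunitInv (graph f) ⋆ whR L'.unit (graph f) ⋆ assocHom L'.arr (graph (eta A₀')) (graph f)
  /-- `f ∘ a ∘ β a ⇒ a' ∘ β f ∘ β a ⇒ a' ∘ β (f ∘ a) ⇒ a' ∘ β (a' ∘ β f) ⇒ a' ∘ β a' ∘ β β f ⇒
  a' ∘ μ ∘ β β f` equals `f ∘ a ∘ β a ⇒ f ∘ a ∘ μ ⇒ a' ∘ β f ∘ μ ⇒ a' ∘ μ ∘ β β f`. -/
  mult_comp :
    whR cell (betaProf L.arr) ⋆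
      assocHom L'.arr (betaProf (graph f)) (betaProf L.arr) ⋆
      whL L'.arr (betaComp (graph f) L.arr ⋆ betaCell cell ⋆ betaCompInv L'.arr f) ⋆
      assocInv L'.arr (betaProf L'.arr) (betaProf (betaProf (graph f))) ⋆
      whR L'.mult (betaProf (betaProf (graph f))) ⋆
      assocHom L'.arr (graph (mu A₀')) (betaProf (betaProf (graph f))) =
    assocHom (graph f) L.arr (betaProf L.arr) ⋆
      whL (graph f) L.mult ⋆
      assocInv (graph f) L.arr (graph (mu A₀)) ⋆
      whR cell (graph (mu A₀)) ⋆
      assocHom L'.arr (betaProf (graph f)) (graph (mu A₀)) ⋆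
      whL L'.arr (muSqInv f)

/-- A continuity structure `A → A'` on a functor `f`: functions from the ultraconvergence arrows
from `a` to `(b_x)_{x : ν}` to those from `f a` to `(f b_x)_{x : ν}`, compatible with reindexing,
identities and composites. -/
@[ext]
structure ContinuityStructure {A₀ A₀' : Type (u + 1)} [Category.{u} A₀] [Category.{u} A₀']
    [IsDiscrete A₀] [IsDiscrete A₀'] (A : UltraconvergenceSpace A₀)
    (A' : UltraconvergenceSpace A₀') (f : A₀ ⥤ A₀') where
  map : ∀ {a : A₀} {S : Ultrafamily.{u} A₀}, El A.arr a S → El A'.arr (f.obj a) ((beta f).obj S)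
  map_act : ∀ {a : A₀} {S T : Ultrafamily.{u} A₀} (g : S ⟶ T) (r : El A.arr a S),
    map (act A.arr (𝟙 a) g r) = act A'.arr (𝟙 (f.obj a)) ((beta f).map g) (map r)
  map_ident : ∀ a : A₀, map (A.ident a) = A'.ident (f.obj a)
  map_comp : ∀ {a : A₀} {S : Ultrafamily.{u} A₀} (r : El A.arr a S)
    {K : S.idx → Ultrafamily.{u} A₀} (s : ∀ x, El A.arr (S.fam x) (K x)),
    map (A.comp r s) = A'.comp (map r) (fun x => map (s x))

section
variable {A₀ : Type (u + 1)} [Category.{u} A₀] [IsDiscrete A₀]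

/-- Arrows of `β A₀`, for a discrete category `A₀`, are reindexings. -/
theorem reindex_ind {S : Ultrafamily.{u} A₀} {motive : ∀ {T : Ultrafamily.{u} A₀}, (S ⟶ T) → Prop}
    (h : ∀ (Y : Type u) (ξ : Ultrafilter Y) (g : Y → S.idx) (hg : ξ.map g = S.ult),
      motive (reindex S ξ g hg)) {T : Ultrafamily.{u} A₀} (f : S ⟶ T) : motive f := by
  refine hom_ind (fun p => ?_) f
  have key : ∀ (Y : Type u) (k : Y → A₀) (ξ : Ultrafilter Y) (g : Y → S.idx)
      (hg : ξ.map g = S.ult) (e : ∀ y, S.fam (g y) ⟶ k y),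
      motive (PreGerm.hom (⟨g, hg, e⟩ : PreHom S ⟨Y, k, ξ⟩)) := by
    intro Y k ξ g hg e
    have : k = fun y => S.fam (g y) := funext fun y => (IsDiscrete.eq_of_hom (e y)).symm
    subst this
    have : e = fun y => 𝟙 (S.fam (g y)) := funext fun y => Subsingleton.elim _ _
    subst this
    exact h Y ξ g hg
  exact key T.idx T.fam T.ult p.fn p.map_fn p.el

namespace UltraconvergenceSpace

variable (A : UltraconvergenceSpace A₀)

/-- The composite of an ultraconvergence arrow and a representative of an element of `β A`. -/
def mulEl {a : A₀} {S : Ultrafamily.{u} A₀} {T : Ultrafamily.{u} (Ultrafamily.{u} A₀)}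
    (r : El A.arr a S) (p : PreGerm (El A.arr) S T) : El A.arr a ((mu A₀).obj T) :=
  A.comp (S := ⟨T.idx, fun y => S.fam (p.fn y), T.ult⟩)
    (act A.arr (𝟙 a) (reindex S T.ult p.fn p.map_fn) r) (K := T.fam) p.el

theorem push_push {a : A₀} {S T U : Ultrafamily.{u} A₀} (f : S ⟶ T) (g : T ⟶ U)
    (r : El A.arr a S) :
    act A.arr (𝟙 a) g (act A.arr (𝟙 a) f r) = act A.arr (𝟙 a) (f ≫ g) r := by
  rw [act_act]; simp

set_option linter.unusedSectionVars false in
theorem reindex_comp (S : Ultrafamily.{u} A₀) {Y Z : Type u} (ξ : Ultrafilter Y)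
    (χ : Ultrafilter Z) (g : Y → S.idx) (hg : ξ.map g = S.ult) (k : Z → Y) (hk : χ.map k = ξ)
    (hh : χ.map (fun z => g (k z)) = S.ult) :
    reindex S ξ g hg ≫ reindex ⟨Y, fun y => S.fam (g y), ξ⟩ χ k hk =
      reindex S χ (fun z => g (k z)) hh := by
  refine germ_congr (H := homs A₀) (S := S) (T := ⟨Z, fun z => S.fam (g (k z)), χ⟩) (fun y => ?_)
  exact Category.comp_id _

theorem left_nat' {a : A₀} {S : Ultrafamily.{u} A₀} (r : El A.arr a S)
    {X : Type u} (χ : Ultrafilter X) (h : X → S.idx) (hh : χ.map h = S.ult)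
    {K : X → Ultrafamily.{u} A₀} (s : ∀ x, El A.arr (S.fam (h x)) (K x))
    {Y : Type u} (ξ : Ultrafilter Y) (g : Y → X) (hg : ξ.map g = χ) (hgh : ξ.map (fun y => h (g y)) = S.ult) :
    A.mulEl (T := ⟨Y, fun y => K (g y), ξ⟩) r ⟨fun y => h (g y), hgh, fun y => s (g y)⟩ =
      act A.arr (𝟙 a) (tensorLeft K ξ g hg) (A.mulEl (T := ⟨X, K, χ⟩) r ⟨h, hh, s⟩) := by
  have := A.left_nat (S := ⟨X, fun x => S.fam (h x), χ⟩) (act A.arr (𝟙 a) (reindex S χ h hh) r) s ξ g hg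
  refine Eq.trans ?_ this
  unfold mulEl
  dsimp only
  rw [push_push, reindex_comp]

theorem mulEl_congr {a : A₀} {S : Ultrafamily.{u} A₀} {T : Ultrafamily.{u} (Ultrafamily.{u} A₀)}
    (r : El A.arr a S) (p q : PreGerm (El A.arr) S T) (hpq : p.germ = q.germ) :
    A.mulEl r p = A.mulEl r q := by
  classical
  obtain ⟨Y, K, ξ⟩ := T
  obtain ⟨f, hf, s⟩ := p
  obtain ⟨f', hf', s'⟩ := q
  have hV := PreGerm.germ_eq.1 hpq
  change ∀ᶠ y in (ξ : Filter Y), (⟨f y, s y⟩ : Σ x, El A.arr (S.fam x) (K y)) = ⟨f' y, s' y⟩ at hV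
  let Φ : ∀ z : Y × ULift.{u} Bool, Σ x, El A.arr (S.fam x) (K z.1) :=
    fun z => if z.2.down then ⟨f' z.1, s' z.1⟩ else ⟨f z.1, s z.1⟩
  let V : Y → Prop := fun y => (⟨f y, s y⟩ : Σ x, El A.arr (S.fam x) (K y)) = ⟨f' y, s' y⟩
  let g₁ : Y → Y × ULift.{u} Bool := fun y => (y, ⟨false⟩)
  let g₂ : Y → Y × ULift.{u} Bool := fun y => (y, ⟨!decide (V y)⟩)
  have h12 : ∀ᶠ y in (ξ : Filter Y), g₁ y = g₂ y := by
    filter_upwards [hV] with y hy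
    have : V y := hy
    simp [g₁, g₂, this]
  have hm : ξ.map g₂ = ξ.map g₁ := by
    refine Ultrafilter.coe_injective ?_
    exact Filter.map_congr (h12.mono fun y hy => hy.symm)
  have hΦ₁ : ∀ y, Φ (g₁ y) = ⟨f y, s y⟩ := fun y => rfl
  have hΦ₂ : ∀ y, Φ (g₂ y) = ⟨f' y, s' y⟩ := by
    intro y
    have aux : ∀ b : Bool, b = !decide (V y) → Φ (y, ⟨b⟩) = ⟨f' y, s' y⟩ := by
      intro b hb
      cases b
      · exact of_decide_eq_true (p := V y) (by simpa using hb)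
      · rfl
    exact aux _ rfl
  have hΦ : (ξ.map g₁).map (fun z => (Φ z).1) = S.ult := hf
  have key : ∀ (ψ : ∀ y, Σ x, El A.arr (S.fam x) (K y)) (f : Y → S.idx) (hf : ξ.map f = S.ult) (s) 
      (hψ : ξ.map (fun y => (ψ y).1) = S.ult)
      (_ : ∀ y, ψ y = ⟨f y, s y⟩), A.mulEl (T := ⟨Y, K, ξ⟩) r ⟨f, hf, s⟩ = A.mulEl (T := ⟨Y, K, ξ⟩) r ⟨fun y => (ψ y).1, hψ, fun y => (ψ y).2⟩ := by
    intro ψ f hf s hψ h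
    cases (funext h : ψ = fun y => ⟨f y, s y⟩)
    rfl
  rw [key (fun y => Φ (g₁ y)) f hf s hf hΦ₁, 
    key (fun y => Φ (g₂ y)) f' hf' s' (by simp only [hΦ₂]; exact hf') hΦ₂]
  have e₁ := A.left_nat' r (ξ.map g₁) (fun z => (Φ z).1) hΦ (K := fun z => K z.1) (fun z => (Φ z).2) ξ g₁ rfl hf
  have e₂ := A.left_nat' r (ξ.map g₁) (fun z => (Φ z).1) hΦ (K := fun z => K z.1) (fun z => (Φ z).2) ξ g₂ hm (by simp only [hΦ₂]; exact hf')
  refine e₁.trans (Eq.trans ?_ e₂.symm)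
  refine congrArg (fun t => act A.arr (𝟙 a) t _) ?_
  refine hom_eq.2 ?_
  refine (eventually_sumUlt (ν := ξ) (ξ := fun y => (K y).ult)).2 ?_
  filter_upwards [h12] with y hy
  refine Filter.Eventually.of_forall fun z => ?_
  have : (⟨false⟩ : ULift.{u} Bool) = ⟨!decide (V y)⟩ := congrArg Prod.snd hy
  change (⟨⟨(y, ⟨false⟩), z⟩, 𝟙 ((K y).fam z)⟩ : Σ x : (Σ w : Y × ULift.{u} Bool, (K w.1).idx), ((K x.1.1).fam x.2 ⟶ (K y).fam z)) = ⟨⟨(y, ⟨!decide (V y)⟩), z⟩, 𝟙 ((K y).fam z)⟩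
  rw [← this]

theorem mulEl_bal {a : A₀} {S S' : Ultrafamily.{u} A₀} {T : Ultrafamily.{u} (Ultrafamily.{u} A₀)}
    (g : PreHom S S') (r : El A.arr a S) (p : PreGerm (El A.arr) S' T) :
    A.mulEl (act A.arr (𝟙 a) g.hom r) p = A.mulEl r (PreGerm.actEl g (PreHom.id T) p) := by
  have key : ∀ (Y : Type u) (k : Y → A₀) (ξ : Ultrafilter Y) (g : Y → S.idx)
      (hg : ξ.map g = S.ult) (e : ∀ y, S.fam (g y) ⟶ k y) (p : PreGerm (El A.arr) ⟨Y, k, ξ⟩ T),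
      A.mulEl (act A.arr (𝟙 a) (PreGerm.hom (⟨g, hg, e⟩ : PreHom S ⟨Y, k, ξ⟩)) r) p =
        A.mulEl r (PreGerm.actEl (⟨g, hg, e⟩ : PreHom S ⟨Y, k, ξ⟩) (PreHom.id T) p) := by
    intro Y k ξ g hg e p
    have : k = fun y => S.fam (g y) := funext fun y => (IsDiscrete.eq_of_hom (e y)).symm
    subst this
    have : e = fun y => 𝟙 (S.fam (g y)) := funext fun y => Subsingleton.elim _ _
    subst this
    have hh : T.ult.map (fun y => g (p.fn y)) = S.ult :=
      (PreGerm.actEl (⟨g, hg, fun y => 𝟙 (S.fam (g y))⟩ :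
        PreHom S ⟨Y, fun y => S.fam (g y), ξ⟩) (PreHom.id T) p).map_fn
    have h2 : act A.arr (𝟙 a) (reindex ⟨Y, fun y => S.fam (g y), ξ⟩ T.ult p.fn p.map_fn)
        (act A.arr (𝟙 a) (reindex S ξ g hg) r) =
        act A.arr (𝟙 a) (reindex S T.ult (fun y => g (p.fn y)) hh) r := by
      rw [push_push, reindex_comp]
    have h3 : p.el = fun y => act A.arr (𝟙 (S.fam (g (p.fn y)))) (𝟙 (T.fam y)) (p.el y) :=
      funext fun y => (act_id A.arr (p.el y)).symm
    exact (congrArg (fun t => A.comp (S := ⟨T.idx, fun y => S.fam (g (p.fn y)), T.ult⟩) t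
      (K := T.fam) p.el) h2).trans (congrArg (A.comp
        (S := ⟨T.idx, fun y => S.fam (g (p.fn y)), T.ult⟩) _ (K := T.fam)) h3)
  exact key S'.idx S'.fam S'.ult g.fn g.map_fn g.el p

theorem mulEl_nat {a : A₀} {S : Ultrafamily.{u} A₀} {T T' : Ultrafamily.{u} (Ultrafamily.{u} A₀)}
    (r : El A.arr a S) (p : PreGerm (El A.arr) S T) (g : PreHom T T') :
    A.mulEl r (PreGerm.actEl (PreHom.id S) g p) = act A.arr (𝟙 a) ((mu A₀).map g.hom) (A.mulEl r p) := by
  obtain ⟨k, hk, e⟩ := g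
  have key : ∀ y, ∃ q : PreHom (T.fam (k y)) (T'.fam y), e y = q.hom := by
    intro y
    refine hom_ind (fun q => ?_) (e y)
    exact ⟨q, rfl⟩
  choose q hq using key
  cases funext hq
  have e1 := A.left_nat' r T.ult p.fn p.map_fn (K := T.fam) p.el T'.ult k hk
    (by rw [← p.map_fn, ← hk, Ultrafilter.map_map]; rfl)
  have e2 := A.right_nat (S := ⟨T'.idx, fun y => S.fam (p.fn (k y)), T'.ult⟩)
    (act A.arr (𝟙 a) (reindex S T'.ult (fun y => p.fn (k y)) 
      (by rw [← p.map_fn, ← hk, Ultrafilter.map_map]; rfl)) r) 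
    (K := fun y => T.fam (k y)) (K' := T'.fam) (fun y => p.el (k y)) q
  have e3 : (mu A₀).map (PreGerm.hom ⟨k, hk, fun y => (q y).hom⟩) = 
      tensorLeft T.fam T'.ult k hk ≫ tensorRight T'.ult q := by
    refine (mu_map_hom k hk q).trans ?_
    refine germ_congr (H := homs A₀) (S := T.flatten) (T := T'.flatten) (fun y => ?_)
    exact (Category.id_comp _).symm
  refine e2.trans ((congrArg (fun t => act A.arr (𝟙 a) _ t) e1).trans ?_)
  refine (A.push_push _ _ _).trans ?_
  exact (congrArg (fun t => act A.arr (𝟙 a) t _) e3).symm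

end UltraconvergenceSpace
end

section
variable {A₀ : Type (u + 1)} [Category.{u} A₀] [IsDiscrete A₀]
namespace UltraconvergenceSpace

variable (A : UltraconvergenceSpace A₀)

/-- The composite of an ultraconvergence arrow and an element of `β A`. -/
def mulQ {a : A₀} {S : Ultrafamily.{u} A₀} {T : Ultrafamily.{u} (Ultrafamily.{u} A₀)}
    (r : El A.arr a S) (x : El (betaProf A.arr) S T) : El A.arr a ((mu A₀).obj T) :=
  Quotient.lift (A.mulEl r) (fun p q h => A.mulEl_congr r p q (Quotient.sound h)) (bgerm x)

theorem mulQ_el' {a : A₀} {S : Ultrafamily.{u} A₀} {T : Ultrafamily.{u} (Ultrafamily.{u} A₀)}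
    (r : El A.arr a S) (p : PreGerm (El A.arr) S T) : A.mulQ r p.el' = A.mulEl r p := rfl

theorem mulQ_act_left {a a' : A₀} (f : a' ⟶ a) {S : Ultrafamily.{u} A₀}
    {T : Ultrafamily.{u} (Ultrafamily.{u} A₀)} (r : El A.arr a S) (x : El (betaProf A.arr) S T) :
    A.mulQ (act A.arr f (𝟙 S) r) x = act A.arr f (𝟙 ((mu A₀).obj T)) (A.mulQ r x) := by
  obtain rfl := IsDiscrete.eq_of_hom f
  obtain rfl : f = 𝟙 _ := Subsingleton.elim _ _
  rw [act_id A.arr, act_id A.arr]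

/-- The identity at `b`, precomposed with an arrow `a ⟶ b` of the discrete category `A₀`. -/
def identAt {a b : A₀} (h : a ⟶ b) : El A.arr a ((eta A₀).obj b) :=
  act A.arr h (𝟙 (unit b)) (A.ident b)

theorem identAt_id (a : A₀) : A.identAt (𝟙 a) = A.ident a := act_id A.arr _

theorem act_identAt {a a' b : A₀} (f : a' ⟶ a) (h : a ⟶ b) :
    act A.arr f (𝟙 ((eta A₀).obj b)) (A.identAt h) = A.identAt (f ≫ h) := by
  refine (act_act A.arr _ _ _ _ _).trans ?_
  exact congrArg (fun t => act A.arr (f ≫ h) t (A.ident b)) (Category.id_comp (𝟙 (unit b)))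

/-- The 2-cell `Γ`, given by the identities. -/
def gammaCell : Cell (one A₀) (A.arr ⊙ graph (eta A₀)) where
  app _ b h := tmk ((eta A₀).obj b) (A.identAt (b := b) (garr h)) (gmk (eta A₀) (𝟙 _))
  naturality {a a' b b'} f g h := by
    obtain rfl := IsDiscrete.eq_of_hom g
    obtain rfl : g = 𝟙 _ := Subsingleton.elim _ _
    have h1 : A.identAt (b := b) (garr (act (one A₀) f (𝟙 b) h)) =
        act A.arr f (𝟙 ((eta A₀).obj b)) (A.identAt (b := b) (garr h)) := by
      rw [act_identAt, garr_act]
      exact congrArg A.identAt (Subsingleton.elim _ _)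
    rw [act_tmk, act_gmk, h1]
    simp

/-- The 2-cell `Δ`, given by the composites. -/
noncomputable def deltaCell : Cell (A.arr ⊙ betaProf A.arr) (A.arr ⊙ graph (mu A₀)) :=
  Cell.ofComp (fun _ T _ r x => tmk ((mu A₀).obj T) (A.mulQ r x) (gmk (mu A₀) (𝟙 _)))
    (fun {a T S S'} g r x => by
      refine hom_ind (fun g => ?_) g
      refine el_ind (fun p => ?_) x
      rw [← hom_id T, act_el', mulQ_el', mulQ_el', mulEl_bal])
    (fun {a a' T T' S} f g r x => by
      rw [mulQ_act_left, act_tmk, act_gmk]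
      have h1 : 𝟙 ((mu A₀).obj T) ≫ 𝟙 ((mu A₀).obj T) ≫ (mu A₀).map g =
        (mu A₀).map g ≫ 𝟙 ((mu A₀).obj T') ≫ (mu A₀).map (𝟙 T') := by simp
      rw [h1, ← act_gmk, ← tmk_bal]
      congr 1
      have h2 : A.mulQ r (act (betaProf A.arr) (𝟙 S) g x) = act A.arr (𝟙 a) ((mu A₀).map g) (A.mulQ r x) := by
        refine hom_ind (fun g => ?_) g
        refine el_ind (fun p => ?_) x
        rw [← hom_id S, act_el', mulQ_el', mulQ_el', mulEl_nat]
      rw [h2, act_act, act_act]; simp)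

theorem mulEl_id {a : A₀} {S : Ultrafamily.{u} A₀} (r : El A.arr a S)
    {K : S.idx → Ultrafamily.{u} A₀} (s : ∀ x, El A.arr (S.fam x) (K x)) (h) :
    A.mulEl (T := ⟨S.idx, K, S.ult⟩) r ⟨fun x => x, h, s⟩ = A.comp r s := by
  have h1 : act A.arr (𝟙 a) (reindex S S.ult (fun x => x) h) r = r := act_id A.arr r
  exact congrArg (fun t => A.comp (S := S) t s) h1

theorem lax_unit_left :
    lunitInv A.arr ⋆ whR A.gammaCell A.arr ⋆ assocHom A.arr (graph (eta A₀)) A.arr ⋆ whL A.arr (etaSq A.arr) ⋆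
      assocInv A.arr (betaProf A.arr) (graph (eta (Ultrafamily.{u} A₀))) ⋆
      whR A.deltaCell (graph (eta (Ultrafamily.{u} A₀))) ⋆
      assocHom A.arr (graph (mu A₀)) (graph (eta (Ultrafamily.{u} A₀))) ⋆
      whL A.arr (graphComp (eta (Ultrafamily.{u} A₀)) (mu A₀) ⋆ graphMap (unitLeft A₀)) ⋆
      runit A.arr = Cell.id A.arr := by
  ext a S r
  change act A.arr (𝟙 a) ((𝟙 ((mu A₀).obj (unit S)) ≫ (mu A₀).map (𝟙 (unit S))) ≫ (unitLeft A₀).app S)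
    (A.mulQ (A.identAt (𝟙 a)) (act (betaProf A.arr) (𝟙 (unit a)) (𝟙 (unit S)) (etaEl r))) = r
  have h1 : A.mulQ (A.identAt (𝟙 a))
      (act (betaProf A.arr) (𝟙 (unit a)) (𝟙 (unit S)) (etaEl r)) =
      A.comp (A.ident a) (K := fun _ => S) (fun _ => r) :=
    (congrArg₂ A.mulQ (A.identAt_id a) (act_id (betaProf A.arr) _)).trans
      (A.mulEl_id (A.ident a) (K := fun _ => S) (fun _ => r) _)
  refine Eq.trans ?_ (A.left_unit r)
  refine congrArg₂ (fun f t => act A.arr (𝟙 a) f t) ?_ h1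
  rw [(mu A₀).map_id]
  exact (congrArg (fun f => f ≫ (unitLeft A₀).app S) (Category.id_comp (𝟙 _))).trans (Category.id_comp _)

theorem lax_unit_right :
    runitInv A.arr ⋆ whL A.arr (betaOneInv A₀ ⋆ betaCell A.gammaCell ⋆ compRep A.arr (eta A₀)) ⋆
      assocInv A.arr (betaProf A.arr) (graph (beta (eta A₀))) ⋆
      whR A.deltaCell (graph (beta (eta A₀))) ⋆
      assocHom A.arr (graph (mu A₀)) (graph (beta (eta A₀))) ⋆
      whL A.arr (graphComp (beta (eta A₀)) (mu A₀) ⋆ graphMap (unitRight A₀)) ⋆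
      runit A.arr = Cell.id A.arr := by
  ext a S r
  let T := (beta (eta A₀)).obj S
  let p : PreGerm (El A.arr) S T := ⟨fun x => x, Ultrafilter.map_id _, fun x => A.ident (S.fam x)⟩
  have h1 : (betaOneInv A₀ ⋆ betaCell A.gammaCell ⋆ compRep A.arr (eta A₀)).app S S (gmk (𝟭 _) (𝟙 S)) =
      tmk T p.el' (gmk (beta (eta A₀)) (𝟙 T)) := by
    refine congrArg (fun t => tmk T t (gmk (beta (eta A₀)) (𝟙 T))) (?_ : PreGerm.el' (P := A.arr) (S := S) (T := T) _ = PreGerm.el' p)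
    refine germ_congr (fun x => ?_)
    exact (act_id A.arr _).trans ((congrArg A.identAt (Subsingleton.elim _ (𝟙 _))).trans
      (A.identAt_id (S.fam x)))
  change (assocInv A.arr (betaProf A.arr) (graph (beta (eta A₀))) ⋆
      whR A.deltaCell (graph (beta (eta A₀))) ⋆
      assocHom A.arr (graph (mu A₀)) (graph (beta (eta A₀))) ⋆
      whL A.arr (graphComp (beta (eta A₀)) (mu A₀) ⋆ graphMap (unitRight A₀)) ⋆
      runit A.arr).app a S (tmk S r ((betaOneInv A₀ ⋆ betaCell A.gammaCell ⋆ compRep A.arr (eta A₀)).app S S (gmk (𝟭 _) (𝟙 S)))) = r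
  rw [h1]
  change act A.arr (𝟙 a) ((𝟙 ((mu A₀).obj T) ≫ (mu A₀).map (𝟙 T)) ≫ (unitRight A₀).app S)
    (A.mulQ r p.el') = r
  have h1 : A.mulQ r p.el' = A.comp r (fun x => A.ident (S.fam x)) :=
    A.mulEl_id r (K := fun x => unit (S.fam x)) (fun x => A.ident (S.fam x)) _
  refine Eq.trans ?_ (A.right_unit r)
  rw [(mu A₀).map_id]
  refine congrArg₂ (fun f t => act A.arr (𝟙 a) f t) ?_ h1
  exact (congrArg (fun f => f ≫ (unitRight A₀).app S) (Category.id_comp (𝟙 _))).trans (Category.id_comp _)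

theorem mulEl_assoc {a : A₀} {S : Ultrafamily.{u} A₀} {T : Ultrafamily.{u} (Ultrafamily.{u} A₀)}
    {U : Ultrafamily.{u} (Ultrafamily.{u} (Ultrafamily.{u} A₀))} (r : El A.arr a S)
    (p : PreGerm (El A.arr) S T) (k : U.idx → T.idx) (hk : U.ult.map k = T.ult)
    (q : ∀ y, PreGerm (El A.arr) (T.fam (k y)) (U.fam y)) (h : U.ult.map (fun y => p.fn (k y)) = S.ult) :
    A.mulEl (A.mulEl r p) (sumEl k hk q) = act A.arr (𝟙 a) ((muAssoc A₀).app U)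
      (A.mulEl (T := (beta (mu A₀)).obj U) r
        ⟨fun y => p.fn (k y), h, fun y => A.mulEl (p.el (k y)) (q y)⟩) := by
  let K : U.idx → Ultrafamily.{u} A₀ := fun y =>
    ⟨(U.fam y).idx, fun z => (T.fam (k y)).fam ((q y).fn z), (U.fam y).ult⟩
  let Sk : Ultrafamily.{u} A₀ := ⟨U.idx, fun y => S.fam (p.fn (k y)), U.ult⟩
  let rk : El A.arr a Sk := act A.arr (𝟙 a) (reindex S U.ult (fun y => p.fn (k y)) h) r
  let ρ : ∀ y, PreHom (T.fam (k y)) (K y) := fun y =>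
    ⟨(q y).fn, (q y).map_fn, fun z => 𝟙 ((T.fam (k y)).fam ((q y).fn z))⟩
  have e1 := A.assoc (S := Sk) rk (K := K)
    (fun y => act A.arr (𝟙 (S.fam (p.fn (k y)))) (ρ y).hom (p.el (k y)))
    (J := fun y z => (U.fam y).fam z) (fun y z => (q y).el z)
  refine Eq.trans ?_ e1
  have e2 := A.left_nat' r T.ult p.fn p.map_fn (K := T.fam) p.el U.ult k hk h
  have e3 := A.right_nat (S := Sk) rk (K := fun y => T.fam (k y)) (K' := K) (fun y => p.el (k y)) ρ
  have e4 : A.comp (S := Sk) rk (K := K) (fun y => act A.arr (𝟙 (S.fam (p.fn (k y)))) (ρ y).hom (p.el (k y))) =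
      act A.arr (𝟙 a) (reindex T.flatten (sumUlt U.ult fun y => (U.fam y).ult)
        (sumEl k hk q).fn (sumEl k hk q).map_fn) (A.mulEl r p) := by
    refine e3.trans ((congrArg (fun t => act A.arr (𝟙 a) _ t) e2).trans ((A.push_push _ _ _).trans ?_))
    refine congrArg (fun f => act A.arr (𝟙 a) f _) ?_
    refine germ_congr (H := homs A₀) (S := T.flatten) (T := flatten ⟨U.idx, K, U.ult⟩) (fun y => ?_)
    exact Category.id_comp _
  exact (congrArg (fun t => A.comp (S := flatten ⟨U.idx, K, U.ult⟩) t
    (K := fun z => (U.fam z.1).fam z.2) (fun z => (q z.1).el z.2)) e4).symm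

theorem lax_assoc :
    assocHom A.arr (betaProf A.arr) (betaProf (betaProf A.arr)) ⋆
      whL A.arr (betaComp A.arr (betaProf A.arr) ⋆ betaCell A.deltaCell ⋆ compRep A.arr (mu A₀)) ⋆
      assocInv A.arr (betaProf A.arr) (graph (beta (mu A₀))) ⋆
      whR A.deltaCell (graph (beta (mu A₀))) ⋆
      assocHom A.arr (graph (mu A₀)) (graph (beta (mu A₀))) ⋆
      whL A.arr (graphComp (beta (mu A₀)) (mu A₀) ⋆ graphMap (muAssoc A₀)) =
    whR A.deltaCell (betaProf (betaProf A.arr)) ⋆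
      assocHom A.arr (graph (mu A₀)) (betaProf (betaProf A.arr)) ⋆
      whL A.arr (muSq A.arr) ⋆
      assocInv A.arr (betaProf A.arr) (graph (mu (Ultrafamily.{u} A₀))) ⋆
      whR A.deltaCell (graph (mu (Ultrafamily.{u} A₀))) ⋆
      assocHom A.arr (graph (mu A₀)) (graph (mu (Ultrafamily.{u} A₀))) ⋆
      whL A.arr (graphComp (mu (Ultrafamily.{u} A₀)) (mu A₀)) := by
  ext a U x
  refine tmk_ind (fun T x y => ?_) x
  refine tmk_ind (fun S r x => ?_) x
  refine el_ind (fun p => ?_) x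
  refine el_ind₂ (fun k hk q => ?_) y
  have hh : U.ult.map (fun y => p.fn (k y)) = S.ult := by
    rw [← p.map_fn, ← hk, Ultrafilter.map_map]; rfl
  let V := (beta (mu A₀)).obj U
  let F := mu (Ultrafamily.{u} A₀) ⋙ mu A₀
  let p₁ : PreGerm (El A.arr) S V :=
    ⟨fun y => p.fn (k y), hh, fun y => A.mulEl (p.el (k y)) (q y)⟩
  have h1 : (betaComp A.arr (betaProf A.arr) ⋆ betaCell A.deltaCell ⋆ compRep A.arr (mu A₀)).app S U
      (tmk T p.el' (PreGerm.el' (rep₂ k hk q))) = tmk V p₁.el' (gmk (beta (mu A₀)) (𝟙 V)) := by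
    refine congrArg (fun t => tmk V t (gmk (beta (mu A₀)) (𝟙 V)))
      (?_ : PreGerm.el' (P := A.arr) (S := S) (T := V) _ = PreGerm.el' p₁)
    refine germ_congr (fun y => ?_)
    exact act_id A.arr _
  have lhs : (assocHom A.arr (betaProf A.arr) (betaProf (betaProf A.arr)) ⋆
      whL A.arr (betaComp A.arr (betaProf A.arr) ⋆ betaCell A.deltaCell ⋆ compRep A.arr (mu A₀)) ⋆
      assocInv A.arr (betaProf A.arr) (graph (beta (mu A₀))) ⋆
      whR A.deltaCell (graph (beta (mu A₀))) ⋆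
      assocHom A.arr (graph (mu A₀)) (graph (beta (mu A₀))) ⋆
      whL A.arr (graphComp (beta (mu A₀)) (mu A₀) ⋆ graphMap (muAssoc A₀))).app a U
        (tmk T (tmk S r p.el') (PreGerm.el' (rep₂ k hk q))) =
      tmk ((mu A₀).obj V) (A.mulEl r p₁) (gmk F ((𝟙 ((mu A₀).obj V) ≫ (mu A₀).map (𝟙 V)) ≫ (muAssoc A₀).app U)) := by
    refine (congrArg (fun t => (assocInv A.arr (betaProf A.arr) (graph (beta (mu A₀))) ⋆
      whR A.deltaCell (graph (beta (mu A₀))) ⋆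
      assocHom A.arr (graph (mu A₀)) (graph (beta (mu A₀))) ⋆
      whL A.arr (graphComp (beta (mu A₀)) (mu A₀) ⋆ graphMap (muAssoc A₀))).app a U (tmk S r t)) h1).trans ?_
    rfl
  let W := (mu (Ultrafamily.{u} A₀)).obj U
  have rhs : (whR A.deltaCell (betaProf (betaProf A.arr)) ⋆
      assocHom A.arr (graph (mu A₀)) (betaProf (betaProf A.arr)) ⋆
      whL A.arr (muSq A.arr) ⋆
      assocInv A.arr (betaProf A.arr) (graph (mu (Ultrafamily.{u} A₀))) ⋆
      whR A.deltaCell (graph (mu (Ultrafamily.{u} A₀))) ⋆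
      assocHom A.arr (graph (mu A₀)) (graph (mu (Ultrafamily.{u} A₀))) ⋆
      whL A.arr (graphComp (mu (Ultrafamily.{u} A₀)) (mu A₀))).app a U
        (tmk T (tmk S r p.el') (PreGerm.el' (rep₂ k hk q))) =
      tmk ((mu A₀).obj W) (A.mulQ (A.mulEl r p) (act (betaProf A.arr) (𝟙 ((mu A₀).obj T)) (𝟙 W)
        (muEl (PreGerm.el' (rep₂ k hk q))))) (gmk F (𝟙 ((mu A₀).obj W) ≫ (mu A₀).map (𝟙 W))) := rfl
  refine lhs.trans (Eq.trans ?_ rhs.symm)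
  have h2 : A.mulQ (A.mulEl r p) (act (betaProf A.arr) (𝟙 ((mu A₀).obj T)) (𝟙 W)
        (muEl (PreGerm.el' (rep₂ k hk q)))) = act A.arr (𝟙 a) ((muAssoc A₀).app U) (A.mulEl r p₁) := by
    rw [act_id (betaProf A.arr), muEl_el']
    exact A.mulEl_assoc r p k hk q hh
  rw [h2]
  refine Eq.trans ?_ (tmk_bal (P := graph F) ((muAssoc A₀).app U) (A.mulEl r p₁) _).symm
  refine congrArg (tmk ((mu A₀).obj V) (A.mulEl r p₁)) ?_
  rw [act_gmk]
  refine congrArg (gmk F) ?_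
  rw [(mu A₀).map_id, (mu A₀).map_id, F.map_id]
  refine (congrArg (fun f => f ≫ (muAssoc A₀).app U) (Category.id_comp (𝟙 _))).trans (Category.id_comp _|>.trans ?_)
  refine Eq.symm ?_
  refine (congrArg (fun f => (muAssoc A₀).app U ≫ f) (?_ : _ = 𝟙 _)).trans (Category.comp_id _)
  exact (Category.comp_id _).trans (Category.id_comp _)

/-- The lax algebra of an ultraconvergence space, with `Γ` given by the identities and `Δ` by the
composites. -/
noncomputable def toLaxAlgebra : LaxAlgebra A₀ where
  arr := A.arr
  small := A.small
  unit := A.gammaCell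
  mult := A.deltaCell
  unit_left := A.lax_unit_left
  unit_right := A.lax_unit_right
  assoc := A.lax_assoc

end UltraconvergenceSpace
end

end Ultraconvergence

/-!
A 2-cell `Θ : f_⋄ ∘ A ⇒ A' ∘ β (f_⋄)` is the same thing as a natural family of functions
`A(a, S) → A'(f a, β f S)`. On the source side the Yoneda lemma applies: the class of `(h, r)` with
`h : b ⟶ f a` is the restriction along `h` of the class of `(𝟙, r)`, so `Θ` is determined by its
values there (`Cell.app_tmk`). On the target side, `β (f_⋄) ≅ (β f)_⋄` gives a bijection
`(A' ∘ β (f_⋄))(b, S) ≅ A'(b, β f S)` (`evalBeta`, `tmkBeta`). Since `A₀` is discrete, naturality of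
the family in `a` is automatic, and naturality in `S` is compatibility with reindexing.

The two axioms of a colax morphism are then evaluated on generators. At `𝟙 : f a ⟶ f a`, both sides
of the unit axiom are classes of `(z, (𝟙, 𝟙))` in `A' ∘ (η_⋄ ∘ f_⋄)`, with `z = Θ(id_a)` on one side
and `z = id_{f a}` on the other. At `((𝟙, r), (g, s))`, both sides of the multiplication axiom are
classes of `(z, (𝟙, 𝟙))` in `A' ∘ (μ_⋄ ∘ β β (f_⋄))`, with `z` the image of the composite
`(s_y)_y · r[g]`, respectively the composite of the images. As `z` is determined by such a class
(`tmk_graph_graph_injective`, `tmk_graph_idBetaBeta_injective`), the axioms say precisely that the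
family preserves identities (`unit_comp_iff`) and composites `(s_y)_y · r[g]` (`mult_comp_iff`). For
a family compatible with reindexing, the latter reduces to composites with `g = id`
(`map_mulEl_iff`), which is the remaining axiom of a continuity structure.
-/

namespace Ultraconvergence

open Ultrafamily

/-! ### Two-cells from `F_⋄ ∘ P` to `P' ∘ β (F_⋄)` as families of functions -/

section Transpose

variable {B C D E : Type (u + 1)} [Category.{u} B] [Category.{u} C] [Category.{u} D]
  [Category.{u} E]

/-- The map `(P ∘ β (F_⋄))(e, T) → P(e, β F T)`, which evaluates along `β (F_⋄) ≅ (β F)_⋄`. -/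
def evalBeta {P : Profunctor.{v} (Ultrafamily.{u} D) E} {F : C ⥤ D} {e : E} {T : Ultrafamily.{u} C}
    (x : El (P ⊙ betaProf (graph F)) e T) : El P e ((beta F).obj T) :=
  evalGraph ((whL P (betaGraph F)).app e T x)

/-- The map `P(e, β F T) → (P ∘ β (F_⋄))(e, T)` that pairs an element with the identity of
`β F T`. -/
def tmkBeta {P : Profunctor.{v} (Ultrafamily.{u} D) E} (F : C ⥤ D) {e : E} {T : Ultrafamily.{u} C}
    (y : El P e ((beta F).obj T)) : El (P ⊙ betaProf (graph F)) e T :=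
  tmk ((beta F).obj T) y ((betaGraphInv F).app _ T (gmk (beta F) (𝟙 _)))

theorem tmkBeta_evalBeta {P : Profunctor.{v} (Ultrafamily.{u} D) E} {F : C ⥤ D} {e : E}
    {T : Ultrafamily.{u} C} (x : El (P ⊙ betaProf (graph F)) e T) :
    tmkBeta F (evalBeta x) = x :=
  betaGraph_inv_evalGraph P F x

theorem evalBeta_tmkBeta {P : Profunctor.{v} (Ultrafamily.{u} D) E} {F : C ⥤ D} {e : E}
    {T : Ultrafamily.{u} C} (y : El P e ((beta F).obj T)) : evalBeta (tmkBeta F y) = y :=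
  act_id P y

theorem evalBeta_act {P : Profunctor.{v} (Ultrafamily.{u} D) E} {F : C ⥤ D} {e e' : E}
    {T T' : Ultrafamily.{u} C} (f : e' ⟶ e) (g : T ⟶ T') (x : El (P ⊙ betaProf (graph F)) e T) :
    evalBeta (act _ f g x) = act P f ((beta F).map g) (evalBeta x) := by
  unfold evalBeta
  rw [Cell.naturality, evalGraph_act]

theorem act_tmkBeta {P : Profunctor.{v} (Ultrafamily.{u} D) E} {F : C ⥤ D} {e e' : E}
    {T T' : Ultrafamily.{u} C} (f : e' ⟶ e) (g : T ⟶ T') (y : El P e ((beta F).obj T)) :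
    act _ f g (tmkBeta F y) = tmkBeta F (act P f ((beta F).map g) y) := by
  rw [← tmkBeta_evalBeta (act _ f g (tmkBeta F y)), evalBeta_act, evalBeta_tmkBeta]

variable {P : Profunctor.{v} (Ultrafamily.{u} C) C} {P' : Profunctor.{v'} (Ultrafamily.{u} D) D}
  {F : C ⥤ D}

/-- The family of functions `P(c, S) → P'(F c, β F S)` underlying a 2-cell
`F_⋄ ∘ P ⇒ P' ∘ β (F_⋄)`: its value at the class of `(𝟙, r)`, evaluated along
`(P' ∘ β (F_⋄))(F c, S) ≅ P'(F c, β F S)`. -/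
def Cell.restrict (Θ : Cell (graph F ⊙ P) (P' ⊙ betaProf (graph F))) {c : C}
    {S : Ultrafamily.{u} C} (r : El P c S) : El P' (F.obj c) ((beta F).obj S) :=
  evalBeta (Θ.app (F.obj c) S (tmk c (gmk F (𝟙 (F.obj c))) r))

theorem Cell.app_tmk_id (Θ : Cell (graph F ⊙ P) (P' ⊙ betaProf (graph F))) {c : C}
    {S : Ultrafamily.{u} C} (r : El P c S) :
    Θ.app (F.obj c) S (tmk c (gmk F (𝟙 (F.obj c))) r) = tmkBeta F (Θ.restrict r) :=
  (tmkBeta_evalBeta _).symm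

/-- A 2-cell `F_⋄ ∘ P ⇒ P' ∘ β (F_⋄)` is determined by its values at the classes of `(𝟙, r)`. -/
theorem Cell.app_tmk (Θ : Cell (graph F ⊙ P) (P' ⊙ betaProf (graph F))) {d : D} {c : C}
    {S : Ultrafamily.{u} C} (h : El (graph F) d c) (r : El P c S) :
    Θ.app d S (tmk c h r) = tmkBeta F (act P' (garr h) (𝟙 _) (Θ.restrict r)) := by
  have e1 : tmk (Q := graph F) c h r =
      act (graph F ⊙ P) (garr h) (𝟙 S) (tmk c (gmk F (𝟙 (F.obj c))) r) := by
    rw [act_tmk, act_gmk, act_id]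
    simp
  rw [e1, Θ.naturality, Θ.app_tmk_id, act_tmkBeta, (beta F).map_id]

theorem Cell.ext_restrict {Θ Θ' : Cell (graph F ⊙ P) (P' ⊙ betaProf (graph F))}
    (h : ∀ {c : C} {S : Ultrafamily.{u} C} (r : El P c S), Θ.restrict r = Θ'.restrict r) :
    Θ = Θ' := by
  ext d S x
  refine tmk_ind (fun c k r => ?_) x
  rw [Θ.app_tmk, Θ'.app_tmk, h]

theorem Cell.restrict_act (Θ : Cell (graph F ⊙ P) (P' ⊙ betaProf (graph F))) {c : C}
    {S T : Ultrafamily.{u} C} (g : S ⟶ T) (r : El P c S) :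
    Θ.restrict (act P (𝟙 c) g r) = act P' (𝟙 (F.obj c)) ((beta F).map g) (Θ.restrict r) := by
  unfold Cell.restrict
  rw [← evalBeta_act, ← Θ.naturality, act_tmk, act_id (graph F)]

/-- The 2-cell `F_⋄ ∘ P ⇒ P' ∘ β (F_⋄)` with given natural values at the classes of `(𝟙, r)`. -/
def Cell.ofRestrict (φ : ∀ {c : C} {S : Ultrafamily.{u} C}, El P c S →
      El P' (F.obj c) ((beta F).obj S))
    (hφ : ∀ {c c' : C} {S T : Ultrafamily.{u} C} (k : c' ⟶ c) (g : S ⟶ T) (r : El P c S),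
      φ (act P k g r) = act P' (F.map k) ((beta F).map g) (φ r)) :
    Cell (graph F ⊙ P) (P' ⊙ betaProf (graph F)) :=
  Cell.ofComp (fun _ _ _ h r => tmkBeta F (act P' (garr h) (𝟙 _) (φ r)))
    (fun k h r => by rw [hφ, garr_act, act_act, (beta F).map_id]; simp)
    (fun f g h r => by rw [hφ, garr_act, act_act, act_tmkBeta, act_act]; simp)

theorem Cell.restrict_ofRestrict (φ : ∀ {c : C} {S : Ultrafamily.{u} C}, El P c S →
      El P' (F.obj c) ((beta F).obj S)) (hφ) {c : C} {S : Ultrafamily.{u} C} (r : El P c S) :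
    (Cell.ofRestrict φ hφ).restrict r = φ r :=
  (evalBeta_tmkBeta _).trans (act_id P' _)

/-! ### Elements of composites with graphs -/

/-- An element `y` of `P(b, G (F c))` is determined by the class of `(y, (𝟙, 𝟙))` in
`P ∘ (G_⋄ ∘ F_⋄)`. -/
theorem tmk_graph_graph_injective {P : Profunctor.{v} E B} (F : C ⥤ D) (G : D ⥤ E) {b : B} {c : C}
    {y y' : El P b (G.obj (F.obj c))}
    (h : tmk (P := graph G ⊙ graph F) (G.obj (F.obj c)) y
        (tmk (F.obj c) (gmk G (𝟙 _)) (gmk F (𝟙 _))) =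
      tmk (G.obj (F.obj c)) y' (tmk (F.obj c) (gmk G (𝟙 _)) (gmk F (𝟙 _)))) : y = y' := by
  have key : ∀ z : El P b (G.obj (F.obj c)),
      evalGraph ((whL P (graphComp F G)).app b c
        (tmk (G.obj (F.obj c)) z (tmk (F.obj c) (gmk G (𝟙 _)) (gmk F (𝟙 _))))) = z := by
    intro z
    change act P (𝟙 b) (𝟙 _ ≫ G.map (𝟙 _)) z = z
    rw [G.map_id, Category.id_comp]
    exact act_id P z
  rw [← key y, h, key]

/-- The element of `β β (F_⋄)` corresponding to an identity under `(β β F)_⋄ ≅ β β (F_⋄)`. -/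
def idBetaBeta (F : C ⥤ D) (U : Ultrafamily.{u} (Ultrafamily.{u} C)) :
    El (betaProf (betaProf (graph F))) ((beta (beta F)).obj U) U :=
  (betaGraphInv (beta F) ⋆ betaCell (betaGraphInv F)).app _ U (gmk (beta (beta F)) (𝟙 _))

/-- The analogue of `tmk_graph_graph_injective` with `β β (F_⋄)` in place of the graph of `β β F`, to
which it is reduced along the identification of the two. -/
theorem tmk_graph_idBetaBeta_injective {P : Profunctor.{v} E B} (F : C ⥤ D)
    (G : Ultrafamily.{u} (Ultrafamily.{u} D) ⥤ E) {b : B}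
    {U : Ultrafamily.{u} (Ultrafamily.{u} C)} {y y' : El P b (G.obj ((beta (beta F)).obj U))}
    (h : tmk (P := graph G ⊙ betaProf (betaProf (graph F))) _ y
        (tmk _ (gmk G (𝟙 _)) (idBetaBeta F U)) =
      tmk _ y' (tmk _ (gmk G (𝟙 _)) (idBetaBeta F U))) : y = y' :=
  tmk_graph_graph_injective (beta (beta F)) G
    (congrArg ((whL P (whL (graph G) (betaCell (betaGraph F) ⋆ betaGraph (beta F)))).app b U) h)

/-- The inverse naturality square of `η` sends the class of the identities to the class of the
identities. -/
theorem etaSqInv_tmk_id (F : C ⥤ D) (c : C) :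
    (etaSqInv F).app ((eta D).obj (F.obj c)) c (tmk ((eta C).obj c)
      ((betaGraphInv F).app _ _ (gmk (beta F) (𝟙 ((beta F).obj ((eta C).obj c)))))
      (gmk (eta C) (𝟙 _))) =
    tmk (F.obj c) (gmk (eta D) (𝟙 _)) (gmk F (𝟙 _)) := by
  refine congrArg (fun t => tmk (F.obj c) (gmk (eta D) t) (gmk F (𝟙 _)))
    (?_ : (𝟙 ((beta F).obj ((eta C).obj c)) ≫ (beta F).map (𝟙 ((eta C).obj c))) ≫
      𝟙 ((beta F).obj ((eta C).obj c)) = 𝟙 _)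
  simp

/-- The inverse naturality square of `μ` sends the class of the identities to the class of the
identities. -/
theorem muSqInv_tmk_id (F : C ⥤ D) (U : Ultrafamily.{u} (Ultrafamily.{u} C)) :
    (muSqInv F).app ((mu D).obj ((beta (beta F)).obj U)) U (tmk ((mu C).obj U)
      ((betaGraphInv F).app _ _ (gmk (beta F) (𝟙 ((beta F).obj ((mu C).obj U)))))
      (gmk (mu C) (𝟙 _))) =
    tmk ((beta (beta F)).obj U) (gmk (mu D) (𝟙 _)) (idBetaBeta F U) := by
  refine congrArg (fun t => tmk ((beta (beta F)).obj U) (gmk (mu D) t) (idBetaBeta F U))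
    (?_ : (𝟙 ((beta F).obj ((mu C).obj U)) ≫ (beta F).map (𝟙 ((mu C).obj U))) ≫
      𝟙 ((beta F).obj ((mu C).obj U)) = 𝟙 _)
  simp

theorem beta_map_reindex (F : C ⥤ D) (S : Ultrafamily.{u} C) {Y : Type u} (ξ : Ultrafilter Y)
    (g : Y → S.idx) (hg : ξ.map g = S.ult) :
    (beta F).map (reindex S ξ g hg) = reindex ((beta F).obj S) ξ g hg :=
  germ_congr (H := homs D) (S := (beta F).obj S) (T := ⟨Y, fun y => F.obj (S.fam (g y)), ξ⟩)
    (fun _ => F.map_id _)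

end Transpose

/-! ### Continuity structures and colax morphisms -/

section Colax

variable {A₀ A₀' : Type (u + 1)} [Category.{u} A₀] [Category.{u} A₀'] [IsDiscrete A₀]
  [IsDiscrete A₀'] {A : UltraconvergenceSpace A₀} {A' : UltraconvergenceSpace A₀'} {f : A₀ ⥤ A₀'}

/-- A 2-cell `Θ` satisfies the unit axiom of a colax morphism iff the underlying functions preserve
identities. -/
theorem unit_comp_iff (Θ : Cell (graph f ⊙ A.arr) (A'.arr ⊙ betaProf (graph f))) :
    runitInv (graph f) ⋆ whL (graph f) A.gammaCell ⋆
      assocInv (graph f) A.arr (graph (eta A₀)) ⋆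
      whR Θ (graph (eta A₀)) ⋆
      assocHom A'.arr (betaProf (graph f)) (graph (eta A₀)) ⋆
      whL A'.arr (etaSqInv f) =
    lunitInv (graph f) ⋆ whR A'.gammaCell (graph f) ⋆
      assocHom A'.arr (graph (eta A₀')) (graph f) ↔
    ∀ a : A₀, Θ.restrict (A.ident a) = A'.ident (f.obj a) := by
  have lhs : ∀ a : A₀, (runitInv (graph f) ⋆ whL (graph f) A.gammaCell ⋆
      assocInv (graph f) A.arr (graph (eta A₀)) ⋆
      whR Θ (graph (eta A₀)) ⋆
      assocHom A'.arr (betaProf (graph f)) (graph (eta A₀)) ⋆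
      whL A'.arr (etaSqInv f)).app (f.obj a) a (gmk f (𝟙 _)) =
      tmk (P := graph (eta A₀') ⊙ graph f) ((eta A₀').obj (f.obj a)) (Θ.restrict (A.ident a))
        (tmk (f.obj a) (gmk (eta A₀') (𝟙 _)) (gmk f (𝟙 _))) := by
    intro a
    change (assocHom A'.arr (betaProf (graph f)) (graph (eta A₀)) ⋆
      whL A'.arr (etaSqInv f)).app (f.obj a) a (tmk ((eta A₀).obj a)
        (Θ.app (f.obj a) _ (tmk a (gmk f (𝟙 _)) (A.identAt (𝟙 a)))) (gmk (eta A₀) (𝟙 _))) = _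
    rw [A.identAt_id]
    exact (congrArg (fun t => (assocHom A'.arr (betaProf (graph f)) (graph (eta A₀)) ⋆
      whL A'.arr (etaSqInv f)).app (f.obj a) a (tmk ((eta A₀).obj a) t (gmk (eta A₀) (𝟙 _))))
      (Θ.app_tmk_id (A.ident a))).trans (congrArg (tmk _ _) (etaSqInv_tmk_id f a))
  have rhs : ∀ a : A₀, (lunitInv (graph f) ⋆ whR A'.gammaCell (graph f) ⋆
      assocHom A'.arr (graph (eta A₀')) (graph f)).app (f.obj a) a (gmk f (𝟙 _)) =
      tmk (P := graph (eta A₀') ⊙ graph f) ((eta A₀').obj (f.obj a)) (A'.ident (f.obj a))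
        (tmk (f.obj a) (gmk (eta A₀') (𝟙 _)) (gmk f (𝟙 _))) := by
    intro a
    rw [← A'.identAt_id]
    rfl
  constructor
  · intro h a
    refine tmk_graph_graph_injective f (eta A₀') ?_
    exact (lhs a).symm.trans ((congrArg (fun c => c.app (f.obj a) a (gmk f (𝟙 _))) h).trans (rhs a))
  · intro h
    ext b a k
    -- As `A₀'` is discrete, `k` is an identity: it suffices to treat the generators with `𝟙`.
    obtain rfl := IsDiscrete.eq_of_hom (garr k)
    obtain rfl : k = gmk f (𝟙 _) := Subsingleton.elim (garr k) (𝟙 _)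
    refine (lhs a).trans (Eq.trans ?_ (rhs a).symm)
    rw [h]
/-- The representative `(g, (φ s_y)_y)` of an element of `β A'`, for a representative
`(g, (s_y)_y)` of an element of `β A`. -/
def PreGerm.mapBeta {P : Profunctor.{v} (Ultrafamily.{u} A₀) A₀}
    {P' : Profunctor.{v'} (Ultrafamily.{u} A₀') A₀'} {f : A₀ ⥤ A₀'}
    (φ : ∀ {a : A₀} {S : Ultrafamily.{u} A₀}, El P a S → El P' (f.obj a) ((beta f).obj S))
    {S : Ultrafamily.{u} A₀} {U : Ultrafamily.{u} (Ultrafamily.{u} A₀)} (p : PreGerm (El P) S U) :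
    PreGerm (El P') ((beta f).obj S) ((beta (beta f)).obj U) :=
  ⟨p.fn, p.map_fn, fun y => φ (p.el y)⟩

/-- A 2-cell `Θ` satisfies the multiplication axiom of a colax morphism iff the underlying functions
preserve composites `(s_y)_y · r[g]` along representatives `(g, (s_y)_y)` of elements of `β A`. -/
theorem mult_comp_iff (Θ : Cell (graph f ⊙ A.arr) (A'.arr ⊙ betaProf (graph f))) :
    whR Θ (betaProf A.arr) ⋆
      assocHom A'.arr (betaProf (graph f)) (betaProf A.arr) ⋆
      whL A'.arr (betaComp (graph f) A.arr ⋆ betaCell Θ ⋆ betaCompInv A'.arr f) ⋆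
      assocInv A'.arr (betaProf A'.arr) (betaProf (betaProf (graph f))) ⋆
      whR A'.deltaCell (betaProf (betaProf (graph f))) ⋆
      assocHom A'.arr (graph (mu A₀')) (betaProf (betaProf (graph f))) =
    assocHom (graph f) A.arr (betaProf A.arr) ⋆
      whL (graph f) A.deltaCell ⋆
      assocInv (graph f) A.arr (graph (mu A₀)) ⋆
      whR Θ (graph (mu A₀)) ⋆
      assocHom A'.arr (betaProf (graph f)) (graph (mu A₀)) ⋆
      whL A'.arr (muSqInv f) ↔
    ∀ {a : A₀} {S : Ultrafamily.{u} A₀} {U : Ultrafamily.{u} (Ultrafamily.{u} A₀)}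
      (r : El A.arr a S) (p : PreGerm (El A.arr) S U),
      Θ.restrict (A.mulEl r p) = A'.mulEl (Θ.restrict r) (p.mapBeta Θ.restrict) := by
  have lhs : ∀ {a : A₀} {S : Ultrafamily.{u} A₀} {U : Ultrafamily.{u} (Ultrafamily.{u} A₀)}
      (r : El A.arr a S) (p : PreGerm (El A.arr) S U),
      (whR Θ (betaProf A.arr) ⋆
      assocHom A'.arr (betaProf (graph f)) (betaProf A.arr) ⋆
      whL A'.arr (betaComp (graph f) A.arr ⋆ betaCell Θ ⋆ betaCompInv A'.arr f) ⋆
      assocInv A'.arr (betaProf A'.arr) (betaProf (betaProf (graph f))) ⋆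
      whR A'.deltaCell (betaProf (betaProf (graph f))) ⋆
      assocHom A'.arr (graph (mu A₀')) (betaProf (betaProf (graph f)))).app (f.obj a) U
        (tmk S (tmk a (gmk f (𝟙 _)) r) p.el') =
      tmk (P := graph (mu A₀') ⊙ betaProf (betaProf (graph f)))
        ((mu A₀').obj ((beta (beta f)).obj U)) (A'.mulEl (Θ.restrict r) (p.mapBeta Θ.restrict))
        (tmk _ (gmk (mu A₀') (𝟙 _)) (idBetaBeta f U)) := by
    intro a S U r p
    change (assocHom A'.arr (betaProf (graph f)) (betaProf A.arr) ⋆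
      whL A'.arr (betaComp (graph f) A.arr ⋆ betaCell Θ ⋆ betaCompInv A'.arr f) ⋆
      assocInv A'.arr (betaProf A'.arr) (betaProf (betaProf (graph f))) ⋆
      whR A'.deltaCell (betaProf (betaProf (graph f))) ⋆
      assocHom A'.arr (graph (mu A₀')) (betaProf (betaProf (graph f)))).app (f.obj a) U
        (tmk S (Θ.app (f.obj a) S (tmk a (gmk f (𝟙 _)) r)) p.el') = _
    rw [Θ.app_tmk_id]
    rfl
  have rhs : ∀ {a : A₀} {S : Ultrafamily.{u} A₀} {U : Ultrafamily.{u} (Ultrafamily.{u} A₀)}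
      (r : El A.arr a S) (p : PreGerm (El A.arr) S U),
      (assocHom (graph f) A.arr (betaProf A.arr) ⋆
      whL (graph f) A.deltaCell ⋆
      assocInv (graph f) A.arr (graph (mu A₀)) ⋆
      whR Θ (graph (mu A₀)) ⋆
      assocHom A'.arr (betaProf (graph f)) (graph (mu A₀)) ⋆
      whL A'.arr (muSqInv f)).app (f.obj a) U (tmk S (tmk a (gmk f (𝟙 _)) r) p.el') =
      tmk (P := graph (mu A₀') ⊙ betaProf (betaProf (graph f)))
        ((mu A₀').obj ((beta (beta f)).obj U)) (Θ.restrict (A.mulEl r p))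
        (tmk _ (gmk (mu A₀') (𝟙 _)) (idBetaBeta f U)) := by
    intro a S U r p
    change (assocHom A'.arr (betaProf (graph f)) (graph (mu A₀)) ⋆
      whL A'.arr (muSqInv f)).app (f.obj a) U (tmk ((mu A₀).obj U)
        (Θ.app (f.obj a) _ (tmk a (gmk f (𝟙 _)) (A.mulEl r p))) (gmk (mu A₀) (𝟙 _))) = _
    rw [Θ.app_tmk_id]
    exact congrArg (tmk _ _) (muSqInv_tmk_id f U)
  constructor
  · intro h a S U r p
    refine tmk_graph_idBetaBeta_injective f (mu A₀') ?_
    exact (rhs r p).symm.trans ((congrArg (fun c => c.app (f.obj a) U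
      (tmk S (tmk a (gmk f (𝟙 _)) r) p.el')) h).symm.trans (lhs r p))
  · intro h
    ext b U x
    refine tmk_ind (fun S x y => ?_) x
    refine tmk_ind (fun a k r => ?_) x
    refine el_ind (fun p => ?_) y
    -- As `A₀'` is discrete, `k` is an identity: it suffices to treat the generators with `𝟙`.
    obtain rfl := IsDiscrete.eq_of_hom (garr k)
    obtain rfl : k = gmk f (𝟙 _) := Subsingleton.elim (garr k) (𝟙 _)
    refine (lhs r p).trans (Eq.trans ?_ (rhs r p).symm)
    exact congrArg (fun t => tmk _ t _) (h r p).symm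

/-- For functions compatible with reindexing, compatibility with composites may be tested on
composites along arbitrary representatives of elements of `β A`. -/
theorem map_mulEl_iff
    (φ : ∀ {a : A₀} {S : Ultrafamily.{u} A₀}, El A.arr a S → El A'.arr (f.obj a) ((beta f).obj S))
    (hφ : ∀ {a : A₀} {S T : Ultrafamily.{u} A₀} (g : S ⟶ T) (r : El A.arr a S),
      φ (act A.arr (𝟙 a) g r) = act A'.arr (𝟙 (f.obj a)) ((beta f).map g) (φ r)) :
    (∀ {a : A₀} {S : Ultrafamily.{u} A₀} {U : Ultrafamily.{u} (Ultrafamily.{u} A₀)}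
      (r : El A.arr a S) (p : PreGerm (El A.arr) S U),
      φ (A.mulEl r p) = A'.mulEl (φ r) (p.mapBeta φ)) ↔
    ∀ {a : A₀} {S : Ultrafamily.{u} A₀} (r : El A.arr a S)
      {K : S.idx → Ultrafamily.{u} A₀} (s : ∀ x, El A.arr (S.fam x) (K x)),
      φ (A.comp r s) = A'.comp (φ r) (fun x => φ (s x)) := by
  constructor
  · intro h a S r K s
    -- `A.comp r s` is the composite along the identity of the index set of `S`.
    have e1 := h (U := ⟨S.idx, K, S.ult⟩) r ⟨fun x => x, Ultrafilter.map_id _, s⟩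
    rw [A.mulEl_id] at e1
    exact e1.trans (A'.mulEl_id (S := (beta f).obj S) (φ r) (K := fun x => (beta f).obj (K x))
      (fun x => φ (s x)) _)
  · intro h a S U r p
    refine (h (S := ⟨U.idx, fun y => S.fam (p.fn y), U.ult⟩) _ p.el).trans ?_
    rw [hφ, beta_map_reindex]
    rfl

/-- The 2-cell of a continuity structure. -/
def ContinuityStructure.cell (F : ContinuityStructure A A' f) :
    Cell (graph f ⊙ A.arr) (A'.arr ⊙ betaProf (graph f)) :=
  Cell.ofRestrict F.map (fun k g r => by
    obtain rfl := IsDiscrete.eq_of_hom k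
    obtain rfl : k = 𝟙 _ := Subsingleton.elim _ _
    rw [F.map_act, f.map_id])

theorem ContinuityStructure.restrict_cell (F : ContinuityStructure A A' f) {a : A₀}
    {S : Ultrafamily.{u} A₀} (r : El A.arr a S) : F.cell.restrict r = F.map r :=
  Cell.restrict_ofRestrict _ _ r

/-- Continuity structures on `f` are structures of a colax morphism on `f_⋄`. -/
noncomputable def continuityEquivColax (A : UltraconvergenceSpace A₀)
    (A' : UltraconvergenceSpace A₀') (f : A₀ ⥤ A₀') :
    ContinuityStructure A A' f ≃ ColaxStructure A.toLaxAlgebra A'.toLaxAlgebra f where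
  toFun F :=
    { cell := F.cell
      unit_comp := (unit_comp_iff F.cell).2 fun a => (F.restrict_cell _).trans (F.map_ident a)
      mult_comp := (mult_comp_iff F.cell).2 <| (map_mulEl_iff _ F.cell.restrict_act).2
        fun r _ s => by simpa only [F.restrict_cell] using F.map_comp r s }
  invFun Θ :=
    { map := Cell.restrict (P := A.arr) (P' := A'.arr) Θ.cell
      map_act := Cell.restrict_act (P := A.arr) (P' := A'.arr) Θ.cell
      map_ident := (unit_comp_iff Θ.cell).1 Θ.unit_comp
      map_comp := (map_mulEl_iff _ (Cell.restrict_act (P := A.arr) (P' := A'.arr) Θ.cell)).1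
        ((mult_comp_iff Θ.cell).1 Θ.mult_comp) }
  left_inv F := by
    ext a S r
    exact F.restrict_cell r
  right_inv Θ := by
    refine ColaxStructure.ext ?_
    exact Cell.ext_restrict (P := A.arr) (P' := A'.arr) fun r =>
      ContinuityStructure.restrict_cell _ r

end Colax

end Ultraconvergence

theorem mainTheorem10 {A₀ A₀' : Type (u + 1)} [Category.{u} A₀] [Category.{u} A₀']
    [CategoryTheory.IsDiscrete A₀] [CategoryTheory.IsDiscrete A₀']
    (A : Ultraconvergence.UltraconvergenceSpace A₀)
    (A' : Ultraconvergence.UltraconvergenceSpace A₀') (f : A₀ ⥤ A₀') :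
    ∃ e : Ultraconvergence.ContinuityStructure A A' f ≃
        Ultraconvergence.ColaxStructure A.toLaxAlgebra A'.toLaxAlgebra f,
      ∀ (F : Ultraconvergence.ContinuityStructure A A' f) (a : A₀)
        (S : Ultraconvergence.Ultrafamily.{u} A₀) (r : Ultraconvergence.El A.arr a S),
        (e F).cell.app (f.obj a) S
            (Ultraconvergence.tmk a (Ultraconvergence.gmk f (𝟙 (f.obj a))) r) =
          Ultraconvergence.tmk ((Ultraconvergence.beta f).obj S) (F.map r)
            ((Ultraconvergence.betaGraphInv f).app ((Ultraconvergence.beta f).obj S) S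
              (Ultraconvergence.gmk (Ultraconvergence.beta f)
                (𝟙 ((Ultraconvergence.beta f).obj S)))) := by
  refine ⟨Ultraconvergence.continuityEquivColax A A' f, fun F a S r => ?_⟩
  refine (Ultraconvergence.Cell.app_tmk_id F.cell r).trans ?_
  rw [F.restrict_cell]
  rfl
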